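/- Let $\Omega\subset\mathbb R^2$ be a polygonal domain (a polygonal domain being a connected set that is the interior of a finite union of closed triangles) and let $\mathcal T_h$ be a partition of $\Omega$ into finitely many pairwise disjoint open polygonal domains $K$ with $\bigcup_K\overline K=\overline\Omega$. Assume that $\mathcal T_h$ is shape regular with parameters $N$ and $\sigma$: each $\overline K$ is the union of at most $N$ closed triangles $T$, these triangles together form a compatible (conforming) triangulation, and $h_T/\rho_T\le\sigma$, where $h_T$ is the diameter of $T$ and $\rho_T$ the radius of the largest disc inscribed in $T$. To each $K$ assign a sampling node $x_K\in K$ and an element patch $S(K)$, a set of elements that contains $K$; let $\mathcal I(K)=\{x_{K'}:K'\in S(K)\}$, denote by $S(K)$ also the interior of $\bigcup_{K'\in S(K)}\overline{K'}$, and put $h_K=\operatorname{diam}K$, $d_K=\operatorname{diam}S(K)$. Let $m\ge1$, let $\mathbb S_m$ be the space of divergence-free polynomial vector fields on $\mathbb R^2$ of total degree at most $m$, and assume that for every $K$ a field $p\in\mathbb S_m$ which vanishes on $\mathcal I(K)$ vanishes on $S(K)$. Put $$\Lambda(m,\mathcal I(K))=\sup_{0\ne p\in\mathbb S_m}\frac{\|p\|_{L^\infty(S(K))}}{\max_{x\in\mathcal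 I(K)}|p(x)|},\qquad \Lambda_m=\max_{K\in\mathcal T_h}\bigl(1+\Lambda(m,\mathcal I(K))\sqrt{\#\mathcal I(K)}\bigr).$$ Then there is a constant $C$ that depends only on $m$, $N$, $\sigma$ and $\gamma$ such that the following holds for all such meshes, nodes and patches. Let $K\in\mathcal T_h$ be such that $S(K)$ is star-shaped with respect to a disc of some radius $r>0$ with $d_K\le\gamma r$, and let $g$ be a vector field that is continuous on $\overline{S(K)}$, belongs to $[H^{m+1}(S(K))]^2$ and satisfies $\operatorname{div}g=0$ in $S(K)$. Then the least-squares problem of minimizing $\sum_{x\in\mathcal I(K)}|g(x)-p(x)|^2$ over $p\in\mathbb S_m$ has a unique solution $\mathcal S_Kg$, and $$\|g-\mathcal S_Kg\|_{L^2(K)}\le C\Lambda_m h_Kd_K^m|g|_{H^{m+1}(S(K))},$$ $$\|\nabla(g-\mathcal S_Kg)\|_{L^2(K)}\le C\bigl(h_K^m+\Lambda_md_K^m\bigr)|g|_{H^{m+1}(S(K))},$$ $$\|g-\mathcal S_Kg\|_{L^2(\partial K)}\le C\Lambda_mh_K^{1/2}d_K^m|g|_{H^{m+1}(S(K))}.$$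 -/

import Mathlib

open MeasureTheory
open scoped ENNReal NNReal ContDiff

noncomputable section

/-- The Euclidean plane. -/
abbrev Plane : Type := EuclideanSpace ℝ (Fin 2)

/-! ### Polygons, triangles, meshes -/

/-- The vertex set of a nondegenerate triangle. -/
def IsTriangle (T : Finset Plane) : Prop :=
  T.card = 3 ∧ AffineIndependent ℝ ((↑) : T → Plane)

/-- The closed triangle with vertex set `T`. -/
def triangle (T : Finset Plane) : Set Plane := convexHull ℝ (T : Set Plane)

/-- The radius of the greatest disc inscribed in a bounded set. -/
def inscribedRadius (A : Set Plane) : ℝ :=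
  sSup {r : ℝ | ∃ c : Plane, Metric.closedBall c r ⊆ A}

/-- A (bounded, open) polygonal domain: a connected set that is the interior of a finite union
of nondegenerate closed triangles. It need be neither convex nor simply connected. -/
def IsPolygonalDomain (U : Set Plane) : Prop :=
  IsConnected U ∧ ∃ 𝒯 : Finset (Finset Plane),
    (∀ T ∈ 𝒯, IsTriangle T) ∧ U = interior (⋃ T ∈ 𝒯, triangle T)

/-- A polygonal mesh of a polygonal domain: finitely many pairwise disjoint open polygons
whose closures cover the domain. -/
structure PolygonalMesh (ι : Type) [Fintype ι] where
  /-- the domain `Ω` -/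
  domain : Set Plane
  /-- the elements `K` -/
  elem : ι → Set Plane
  domain_polygonal : IsPolygonalDomain domain
  elem_polygonal : ∀ K, IsPolygonalDomain (elem K)
  elem_disjoint : ∀ K K', K ≠ K' → Disjoint (elem K) (elem K')
  cover : ⋃ K, closure (elem K) = closure domain

/-- Shape regularity with parameters `N` and `σ`: every element is decomposed into at most `N`
triangles `T` with `h_T / ρ_T ≤ σ`, and all these triangles together form a compatible
(conforming) triangulation, i.e. two of them meet in the convex hull of their common vertices. -/
def PolygonalMesh.ShapeRegular {ι : Type} [Fintype ι] (M : PolygonalMesh ι)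
    (N : ℕ) (σ : ℝ) : Prop :=
  ∃ 𝒯 : ι → Finset (Finset Plane),
    (∀ K, (𝒯 K).card ≤ N ∧ closure (M.elem K) = ⋃ T ∈ 𝒯 K, triangle T) ∧
    (∀ K, ∀ T ∈ 𝒯 K, IsTriangle T ∧
      Metric.diam (triangle T) / inscribedRadius (triangle T) ≤ σ) ∧
    (∀ K K', ∀ T ∈ 𝒯 K, ∀ T' ∈ 𝒯 K',
      triangle T ∩ triangle T' = convexHull ℝ ((T : Set Plane) ∩ (T' : Set Plane)))

/-- Sampling nodes `x_K ∈ K` and element patches `S(K) ∋ K`. -/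
structure PatchData {ι : Type} [Fintype ι] (M : PolygonalMesh ι) where
  node : ι → Plane
  patch : ι → Finset ι
  node_mem : ∀ K, node K ∈ M.elem K
  self_mem : ∀ K, K ∈ patch K

/-- The (open) region occupied by the element patch `S(K)`. -/
def PatchData.region {ι : Type} [Fintype ι] {M : PolygonalMesh ι} (P : PatchData M)
    (K : ι) : Set Plane :=
  interior (⋃ K' ∈ P.patch K, closure (M.elem K'))

/-- `D` is star-shaped with respect to a disc whose radius `r` satisfies `diam D ≤ γ r`,
i.e. the chunkiness parameter of `D` is controlled by `γ`. -/
def StarShapedWithChunkiness (D : Set Plane) (γ : ℝ) : Prop :=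
  ∃ (c : Plane) (r : ℝ), 0 < r ∧ Metric.ball c r ⊆ D ∧
    (∀ y ∈ Metric.ball c r, StarConvex ℝ y D) ∧ Metric.diam D ≤ γ * r

/-! ### Weak derivatives and Sobolev spaces -/

/-- The classical partial derivative `∂_i φ`. -/
def partialDeriv (i : Fin 2) (φ : Plane → ℝ) : Plane → ℝ :=
  fun x => fderiv ℝ φ x (EuclideanSpace.single i 1)

/-- The classical derivative `∂^α φ` for the multi-index `α`. -/
def multiPartialDeriv (α : ℕ × ℕ) (φ : Plane → ℝ) : Plane → ℝ :=
  (partialDeriv 0)^[α.1] ((partialDeriv 1)^[α.2] φ)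

/-- Test functions on the open set `D`. -/
def IsTestFunction (D : Set Plane) (φ : Plane → ℝ) : Prop :=
  ContDiff ℝ ∞ φ ∧ HasCompactSupport φ ∧ tsupport φ ⊆ D

/-- `w` is the weak derivative `∂^α u` on the open set `D`. -/
def IsWeakDeriv (D : Set Plane) (α : ℕ × ℕ) (u w : Plane → ℝ) : Prop :=
  LocallyIntegrableOn u D ∧ LocallyIntegrableOn w D ∧
    ∀ φ : Plane → ℝ, IsTestFunction D φ →
      ∫ x in D, u x * multiPartialDeriv α φ x =
        (-1 : ℝ) ^ (α.1 + α.2) * ∫ x in D, w x * φ x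

/-- The norm of the weak derivative `∂^α u` in `L²(D)`; it is `∞` if `u` has no weak derivative
`∂^α u` in `L²(D)`. (The weak derivative is unique almost everywhere.) -/
def weakDerivNorm (D : Set Plane) (α : ℕ × ℕ) (u : Plane → ℝ) : ℝ≥0∞ :=
  ⨅ (w : Plane → ℝ) (_ : IsWeakDeriv D α u w), eLpNorm w 2 (volume.restrict D)

/-- Membership of a vector field in `[H^k(D)]²`. -/
def MemSobolev (k : ℕ) (D : Set Plane) (v : Plane → Plane) : Prop :=
  ∀ i : Fin 2, ∀ α : ℕ × ℕ, α.1 + α.2 ≤ k →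
    ∃ w : Plane → ℝ, IsWeakDeriv D α (fun x => v x i) w ∧ MemLp w 2 (volume.restrict D)

/-- The seminorm `|v|_{H^k(D)}` of a vector field: the square root of the sum, over the components
and over the multi-indices of order `k`, of the squared `L²(D)` norms of the weak derivatives. For
`k = 1` it is `‖∇v‖_{L²(D)}`. -/
def sobolevSeminorm (k : ℕ) (D : Set Plane) (v : Plane → Plane) : ℝ≥0∞ :=
  (∑ i : Fin 2, ∑ α ∈ Finset.HasAntidiagonal.antidiagonal k,
    weakDerivNorm D α (fun x => v x i) ^ 2) ^ (1 / 2 : ℝ)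

/-- `div v = 0` on `D`, in the weak sense. -/
def WeaklyDivFree (D : Set Plane) (v : Plane → Plane) : Prop :=
  ∀ φ : Plane → ℝ, IsTestFunction D φ →
    ∫ x in D, ∑ i : Fin 2, v x i * partialDeriv i φ x = 0

/-- Membership in the solenoidal space `𝑺^k(D)`. -/
def MemSolenoidalSobolev (k : ℕ) (D : Set Plane) (v : Plane → Plane) : Prop :=
  MemSobolev k D v ∧ WeaklyDivFree D v

/-! ### Solenoidal polynomials and the reconstruction -/

/-- A pair of polynomials in two variables. -/
abbrev PolyField : Type := Fin 2 → MvPolynomial (Fin 2) ℝ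

/-- The vector field on the plane given by a pair of polynomials. -/
def PolyField.toFun (p : PolyField) : Plane → Plane :=
  fun x => WithLp.toLp 2 fun i => MvPolynomial.eval (fun j => x j) (p i)

/-- The solenoidal polynomial vector fields of total degree at most `m`. -/
def solenoidalPoly (m : ℕ) : Set PolyField :=
  {p | (∀ i, (p i).totalDegree ≤ m) ∧ ∑ i, MvPolynomial.pderiv i (p i) = 0}

section Reconstruction

variable {ι : Type} [Fintype ι] {M : PolygonalMesh ι}

/-- Unisolvence: for every element `K`, a solenoidal polynomial field of degree at most `m`
which vanishes at the sampling nodes of `S(K)` vanishes on `S(K)`. -/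
def PatchData.Unisolvent (P : PatchData M) (m : ℕ) : Prop :=
  ∀ K, ∀ p ∈ solenoidalPoly m,
    (∀ K' ∈ P.patch K, p.toFun (P.node K') = 0) → ∀ x ∈ P.region K, p.toFun x = 0

/-- `p` solves the discrete least-squares problem for `g` on `S(K)`. -/
def PatchData.IsLeastSquares (P : PatchData M) (m : ℕ) (K : ι) (g : Plane → Plane)
    (p : PolyField) : Prop :=
  p ∈ solenoidalPoly m ∧ ∀ q ∈ solenoidalPoly m,
    ∑ K' ∈ P.patch K, ‖g (P.node K') - p.toFun (P.node K')‖ ^ 2 ≤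
      ∑ K' ∈ P.patch K, ‖g (P.node K') - q.toFun (P.node K')‖ ^ 2

/-- `Λ(m, I(K))`: the largest quotient of the `L^∞(S(K))` norm and the maximum over the sampling
nodes, for solenoidal polynomial fields (the quotient `0 / 0` counts as `0`). -/
def PatchData.lebesgueConst (P : PatchData M) (m : ℕ) (K : ι) : ℝ≥0∞ :=
  ⨆ p ∈ solenoidalPoly m,
    eLpNorm p.toFun ∞ (volume.restrict (P.region K)) /
      ⨆ K' ∈ P.patch K, ‖p.toFun (P.node K')‖ₑ

/-- `Λ_m`: the maximum over the elements `K` of `1 + Λ(m, I(K)) (#I(K))^{1/2}`. -/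
def PatchData.lebesgueMax (P : PatchData M) (m : ℕ) : ℝ≥0∞ :=
  ⨆ K, (1 + P.lebesgueConst m K * ((P.patch K).card : ℝ≥0∞) ^ (1 / 2 : ℝ))

end Reconstruction

end

/-!
The error `g - 𝒮_K g` is first bounded uniformly on the closed patch, and the three estimates
follow from that bound and the size of the element.

*Polynomial approximation.* On a set `D` that is star-shaped with respect to a disc `B`, the
average over `y ∈ B` of the Taylor polynomials of `g` at `y` is again a solenoidal field of degree
at most `m`, because the Taylor polynomial commutes with differentiation and averaging is linear
(`exists_average_taylorPoly`). Taylor's formula expresses the error at `x` by the derivatives of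
order `m + 1` on the segments from `B` to `x` with the weight `(1 - s)^m`. As `m ≥ 1`, this weight
absorbs the Jacobian of the substitution `z = (1 - s) y + s x`, so that the Cauchy–Schwarz
inequality gives a uniform bound by `C d^m |g|_{H^{m+1}}` (`enorm_sub_average_taylorPoly_le`). In
the mean square no weight is needed, and the same bound holds for the gradients
(`eLpNorm_sub_average_taylorPoly_le`); `exists_solenoidal_approx` combines the two.

*Rough fields.* For `g` in the Sobolev space the estimates are applied to the mollifications of `g`
on the erosions of `D`. These are star-shaped with respect to a smaller disc, and on them
mollification commutes with weak derivatives and preserves vanishing divergence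
(`exists_mollified_approx`). The bounds do not depend on the mollification parameter. It is enough
to let that parameter tend to zero in the final inequalities, pointwise for the values and by
Fatou's lemma for the derivatives.

*Stability.* Let `q` be a solenoidal polynomial whose error at the nodes is at most `A`. By
minimality the least-squares solution `p` satisfies `|q - p| ≤ 2 √#I(K) A` at the nodes
(`PatchData.IsLeastSquares.norm_sub_le`), hence `|q - p| ≤ 2 Λ √#I(K) A` on the patch. In the limit
`|g - p| ≤ C (1 + Λ √#I(K)) d^m |g|_{H^{m+1}}` on the closed patch
(`PatchData.IsLeastSquares.enorm_sub_le`).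

*The element.* The area of `K` is at most a multiple of `h_K²`. The boundary of `K` is contained in
the edges of at most `N` triangles and has length at most `3 N h_K`
(`hausdorffMeasure_frontier_le`). The gradient of `q - p` is controlled by the inverse inequality
`exists_eLpNorm_pderiv_le`: Markov's inequality on a triangle costs the factor `1 / ρ_T`, which
shape regularity and the area of the triangle compensate
(`PatchData.IsLeastSquares.eLpNorm_sub_pderiv_le`).
-/

/-! ### Partial derivatives of smooth functions -/

theorem ContDiff.partialDeriv {u : Plane → ℝ} (hu : ContDiff ℝ ∞ u) (i : Fin 2) :
    ContDiff ℝ ∞ (partialDeriv i u) :=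
  (hu.fderiv_right (m := ∞) (by simp)).clm_apply contDiff_const

theorem ContDiff.iterate_partialDeriv {u : Plane → ℝ} (hu : ContDiff ℝ ∞ u) (i : Fin 2) (k : ℕ) :
    ContDiff ℝ ∞ ((_root_.partialDeriv i)^[k] u) := by
  induction k with
  | zero => exact hu
  | succ k ih => rw [Function.iterate_succ_apply']; exact ih.partialDeriv i

theorem ContDiff.multiPartialDeriv {u : Plane → ℝ} (hu : ContDiff ℝ ∞ u) (α : ℕ × ℕ) :
    ContDiff ℝ ∞ (multiPartialDeriv α u) :=
  (hu.iterate_partialDeriv 1 α.2).iterate_partialDeriv 0 α.1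

theorem partialDeriv_comm {u : Plane → ℝ} (hu : ContDiff ℝ ∞ u) (i j : Fin 2) :
    partialDeriv i (partialDeriv j u) = partialDeriv j (partialDeriv i u) := by
  have key : ∀ (i j : Fin 2) (x : Plane), partialDeriv i (partialDeriv j u) x =
      fderiv ℝ (fderiv ℝ u) x (EuclideanSpace.single i 1) (EuclideanSpace.single j 1) := by
    intro i j x
    have hd : DifferentiableAt ℝ (fderiv ℝ u) x :=
      ((hu.fderiv_right (m := ∞) (by simp)).differentiable (by simp)).differentiableAt
    unfold partialDeriv
    rw [fderiv_clm_apply hd (differentiableAt_const _)]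
    simp
  funext x
  rw [key, key]
  have h2 : minSmoothness ℝ 2 ≤ (∞ : ℕ∞ω) := by
    rw [minSmoothness_of_isRCLikeNormedField]
    exact WithTop.coe_le_coe.2 le_top
  exact (hu.contDiffAt.isSymmSndFDerivAt (x := x) h2) _ _

theorem partialDeriv_iterate_comm {u : Plane → ℝ} (hu : ContDiff ℝ ∞ u) (i j : Fin 2) (k : ℕ) :
    partialDeriv i ((partialDeriv j)^[k] u) = (partialDeriv j)^[k] (partialDeriv i u) := by
  induction k with
  | zero => rfl
  | succ k ih =>
    rw [Function.iterate_succ_apply', Function.iterate_succ_apply', ← ih,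
      partialDeriv_comm (hu.iterate_partialDeriv j k)]

theorem partialDeriv_zero_multiPartialDeriv (u : Plane → ℝ) (a b : ℕ) :
    partialDeriv 0 (multiPartialDeriv (a, b) u) = multiPartialDeriv (a + 1, b) u := by
  simp only [multiPartialDeriv, Function.iterate_succ_apply']

theorem partialDeriv_one_multiPartialDeriv {u : Plane → ℝ} (hu : ContDiff ℝ ∞ u) (a b : ℕ) :
    partialDeriv 1 (multiPartialDeriv (a, b) u) = multiPartialDeriv (a, b + 1) u := by
  simp only [multiPartialDeriv]
  rw [partialDeriv_iterate_comm (hu.iterate_partialDeriv 1 b), Function.iterate_succ_apply']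

theorem multiPartialDeriv_partialDeriv_zero {u : Plane → ℝ} (hu : ContDiff ℝ ∞ u) (a b : ℕ) :
    multiPartialDeriv (a, b) (partialDeriv 0 u) = multiPartialDeriv (a + 1, b) u := by
  simp only [multiPartialDeriv]
  rw [← partialDeriv_iterate_comm hu, Function.iterate_succ_apply]

theorem multiPartialDeriv_partialDeriv_one (u : Plane → ℝ) (a b : ℕ) :
    multiPartialDeriv (a, b) (partialDeriv 1 u) = multiPartialDeriv (a, b + 1) u := by
  simp only [multiPartialDeriv, Function.iterate_succ_apply]

theorem partialDeriv_eventuallyEq {u v : Plane → ℝ} {x : Plane} (h : u =ᶠ[nhds x] v) (i : Fin 2) :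
    partialDeriv i u =ᶠ[nhds x] partialDeriv i v := by
  filter_upwards [h.fderiv (𝕜 := ℝ)] with y hy
  simp [partialDeriv, hy]

theorem multiPartialDeriv_eventuallyEq {u v : Plane → ℝ} {x : Plane} (h : u =ᶠ[nhds x] v)
    (α : ℕ × ℕ) : multiPartialDeriv α u =ᶠ[nhds x] multiPartialDeriv α v := by
  have it : ∀ (i : Fin 2) (k : ℕ) {u v : Plane → ℝ}, u =ᶠ[nhds x] v →
      (partialDeriv i)^[k] u =ᶠ[nhds x] (partialDeriv i)^[k] v := by
    intro i k
    induction k with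
    | zero => intro u v h; exact h
    | succ k ih =>
      intro u v h
      rw [Function.iterate_succ_apply, Function.iterate_succ_apply]
      exact ih (partialDeriv_eventuallyEq h i)
  exact it 0 _ (it 1 _ h)

theorem partialDeriv_add {u v : Plane → ℝ} (hu : ContDiff ℝ ∞ u) (hv : ContDiff ℝ ∞ v)
    (i : Fin 2) : partialDeriv i (u + v) = partialDeriv i u + partialDeriv i v := by
  funext x
  simp only [partialDeriv, Pi.add_apply]
  rw [fderiv_add (hu.differentiable (by simp)).differentiableAt
    (hv.differentiable (by simp)).differentiableAt]
  rfl

theorem multiPartialDeriv_add {u v : Plane → ℝ} (hu : ContDiff ℝ ∞ u) (hv : ContDiff ℝ ∞ v)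
    (α : ℕ × ℕ) :
    multiPartialDeriv α (u + v) = multiPartialDeriv α u + multiPartialDeriv α v := by
  have it : ∀ (i : Fin 2) (k : ℕ) {u v : Plane → ℝ}, ContDiff ℝ ∞ u → ContDiff ℝ ∞ v →
      (partialDeriv i)^[k] (u + v) = (partialDeriv i)^[k] u + (partialDeriv i)^[k] v := by
    intro i k
    induction k with
    | zero => intros; rfl
    | succ k ih =>
      intro u v hu hv
      simp only [Function.iterate_succ_apply]
      rw [partialDeriv_add hu hv, ih (hu.partialDeriv i) (hv.partialDeriv i)]
  simp only [multiPartialDeriv]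
  rw [it 1 _ hu hv, it 0 _ (hu.iterate_partialDeriv 1 _) (hv.iterate_partialDeriv 1 _)]

theorem multiPartialDeriv_zero_fun (α : ℕ × ℕ) :
    multiPartialDeriv α (fun _ : Plane => (0 : ℝ)) = fun _ => 0 := by
  have h : ∀ i : Fin 2, partialDeriv i (fun _ : Plane => (0 : ℝ)) = fun _ => 0 := by
    intro i; funext x; simp [partialDeriv]
  simp only [multiPartialDeriv]
  rw [Function.iterate_fixed (h 1), Function.iterate_fixed (h 0)]

theorem plane_eq_sum (v : Plane) :
    v = v 0 • EuclideanSpace.single 0 (1 : ℝ) + v 1 • EuclideanSpace.single 1 (1 : ℝ) := by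
  ext i
  fin_cases i <;> simp

theorem fderiv_eq_partialDeriv (u : Plane → ℝ) (x v : Plane) :
    fderiv ℝ u x v = v 0 * partialDeriv 0 u x + v 1 * partialDeriv 1 u x := by
  conv_lhs => rw [plane_eq_sum v]
  simp [partialDeriv]

theorem hasDerivAt_along_line {u : Plane → ℝ} (hu : ContDiff ℝ ∞ u) (y v : Plane) (s : ℝ) :
    HasDerivAt (fun s : ℝ => u (y + s • v))
      (v 0 * partialDeriv 0 u (y + s • v) + v 1 * partialDeriv 1 u (y + s • v)) s := by
  have h1 : HasDerivAt (fun s : ℝ => y + s • v) v s := by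
    simpa using ((hasDerivAt_id s).smul_const v).const_add y
  have h2 := ((hu.differentiable (by simp)) (y + s • v)).hasFDerivAt
  rw [← fderiv_eq_partialDeriv]
  exact h2.comp_hasDerivAt s h1

/-! ### Taylor polynomials in two variables -/

/-- The `k`-th derivative of `u` at `z` in the direction `v`, expanded in partial derivatives. -/
noncomputable def directionalDeriv (k : ℕ) (u : Plane → ℝ) (v z : Plane) : ℝ :=
  ∑ α ∈ Finset.HasAntidiagonal.antidiagonal k,
    (k.choose α.1 : ℝ) * (v 0 ^ α.1 * v 1 ^ α.2 * multiPartialDeriv α u z)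

/-- Pascal's rule for binomial coefficients expands the iterated derivative along a line. -/
theorem iteratedDeriv_along_line {u : Plane → ℝ} (hu : ContDiff ℝ ∞ u) (y v : Plane) (k : ℕ) :
    iteratedDeriv k (fun s : ℝ => u (y + s • v)) = fun s => directionalDeriv k u v (y + s • v) := by
  induction k with
  | zero => funext s; simp [directionalDeriv, multiPartialDeriv]
  | succ k ih =>
    rw [iteratedDeriv_succ, ih]
    funext s
    have hd : ∀ α : ℕ × ℕ, HasDerivAt (fun s : ℝ => multiPartialDeriv α u (y + s • v))
        (v 0 * multiPartialDeriv (α.1 + 1, α.2) u (y + s • v) +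
          v 1 * multiPartialDeriv (α.1, α.2 + 1) u (y + s • v)) s := by
      rintro ⟨a, b⟩
      have := hasDerivAt_along_line (hu.multiPartialDeriv (a, b)) y v s
      rwa [partialDeriv_zero_multiPartialDeriv, partialDeriv_one_multiPartialDeriv hu] at this
    have h := HasDerivAt.fun_sum (u := Finset.HasAntidiagonal.antidiagonal k) (fun α _ =>
      ((hd α).const_mul (v 0 ^ α.1 * v 1 ^ α.2)).const_mul (k.choose α.1 : ℝ))
    simp only [directionalDeriv]
    rw [h.deriv, Finset.sum_antidiagonal_choose_succ_mul
      (fun a b => v 0 ^ a * v 1 ^ b * multiPartialDeriv (a, b) u (y + s • v)) k,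
      ← Finset.sum_add_distrib]
    refine Finset.sum_congr rfl fun α hα => ?_
    have hk : α.1 + α.2 = k := Finset.HasAntidiagonal.mem_antidiagonal.1 hα
    have : k.choose α.2 = k.choose α.1 := by
      rw [← hk]; exact (Nat.choose_symm_add).symm
    rw [this]
    ring

/-- The monomial `(X₀ - y₀)^a (X₁ - y₁)^b`. -/
noncomputable def centredMonomial (y : Plane) (a b : ℕ) : MvPolynomial (Fin 2) ℝ :=
  (MvPolynomial.X 0 - MvPolynomial.C (y 0)) ^ a * (MvPolynomial.X 1 - MvPolynomial.C (y 1)) ^ b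

/-- The Taylor polynomial of `u` at `y` collecting the derivatives of order less than `n`. -/
noncomputable def taylorPoly (n : ℕ) (u : Plane → ℝ) (y : Plane) : MvPolynomial (Fin 2) ℝ :=
  ∑ k ∈ Finset.range n, ∑ α ∈ Finset.HasAntidiagonal.antidiagonal k,
    MvPolynomial.C (multiPartialDeriv α u y / (α.1.factorial * α.2.factorial)) *
      centredMonomial y α.1 α.2

theorem totalDegree_taylorPoly_le (n : ℕ) (u : Plane → ℝ) (y : Plane) :
    (taylorPoly (n + 1) u y).totalDegree ≤ n := by
  refine MvPolynomial.totalDegree_finsetSum_le fun k hk => ?_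
  refine MvPolynomial.totalDegree_finsetSum_le fun α hα => ?_
  have hk' : k ≤ n := Nat.lt_succ_iff.1 (Finset.mem_range.1 hk)
  have hα' : α.1 + α.2 = k := Finset.HasAntidiagonal.mem_antidiagonal.1 hα
  have h1 : ∀ i : Fin 2, (MvPolynomial.X i - MvPolynomial.C (y i) :
      MvPolynomial (Fin 2) ℝ).totalDegree ≤ 1 := by
    intro i
    refine (MvPolynomial.totalDegree_sub_C_le _ _).trans ?_
    simp
  refine (MvPolynomial.totalDegree_mul _ _).trans ?_
  rw [MvPolynomial.totalDegree_C, zero_add]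
  refine (MvPolynomial.totalDegree_mul _ _).trans ?_
  have h2 := (MvPolynomial.totalDegree_pow (MvPolynomial.X 0 - MvPolynomial.C (y 0)) α.1).trans
    (Nat.mul_le_mul_left _ (h1 0))
  have h3 := (MvPolynomial.totalDegree_pow (MvPolynomial.X 1 - MvPolynomial.C (y 1)) α.2).trans
    (Nat.mul_le_mul_left _ (h1 1))
  omega

theorem eval_taylorPoly (n : ℕ) (u : Plane → ℝ) (y x : Plane) :
    MvPolynomial.eval (fun j => x j) (taylorPoly n u y) =
      ∑ k ∈ Finset.range n, (k.factorial : ℝ)⁻¹ * directionalDeriv k u (x - y) y := by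
  simp only [taylorPoly, directionalDeriv, centredMonomial, map_sum, map_mul, map_pow, map_sub,
    MvPolynomial.eval_C, MvPolynomial.eval_X, Finset.mul_sum]
  refine Finset.sum_congr rfl fun k _ => Finset.sum_congr rfl fun α hα => ?_
  have hα' : α.1 + α.2 = k := Finset.HasAntidiagonal.mem_antidiagonal.1 hα
  have h1 : (k.factorial : ℝ) ≠ 0 := by positivity
  have hc : (k.choose α.1 : ℝ) * (α.1.factorial * α.2.factorial) = k.factorial := by
    rw [← hα']
    have := Nat.add_choose_mul_factorial_mul_factorial α.1 α.2
    rw [← mul_assoc]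
    rw [Nat.choose_symm_add]
    exact_mod_cast this
  have h2 : (α.1.factorial : ℝ) ≠ 0 := by positivity
  have h3 : (α.2.factorial : ℝ) ≠ 0 := by positivity
  simp only [PiLp.sub_apply]
  rw [← hc] at h1 ⊢
  have h4 : (k.choose α.1 : ℝ) ≠ 0 := left_ne_zero_of_mul h1
  field_simp

/-- The derivative of a Taylor polynomial is the Taylor polynomial of the derivative. -/
theorem pderiv_taylorPoly (n : ℕ) {u : Plane → ℝ} (hu : ContDiff ℝ ∞ u) (y : Plane) (i : Fin 2) :
    MvPolynomial.pderiv i (taylorPoly (n + 1) u y) = taylorPoly n (partialDeriv i u) y := by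
  have hC : ∀ (c d : ℝ) (q : MvPolynomial (Fin 2) ℝ),
      MvPolynomial.C c * (MvPolynomial.C d * q) = MvPolynomial.C (c * d) * q := by
    intros; rw [← mul_assoc, ← MvPolynomial.C_mul]
  have e0 : ∀ a b : ℕ, MvPolynomial.pderiv 0 (centredMonomial y a b) =
      MvPolynomial.C (a : ℝ) * centredMonomial y (a - 1) b := by
    intro a b
    simp [centredMonomial, MvPolynomial.pderiv_X]
    ring
  have e1 : ∀ a b : ℕ, MvPolynomial.pderiv 1 (centredMonomial y a b) =
      MvPolynomial.C (b : ℝ) * centredMonomial y a (b - 1) := by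
    intro a b
    simp [centredMonomial, MvPolynomial.pderiv_X]
    ring
  simp only [taylorPoly, map_sum, MvPolynomial.pderiv_C_mul]
  rw [Finset.sum_range_succ']
  fin_cases i
  · simp only [Fin.zero_eta, e0, hC]
    simp only [Finset.Nat.sum_antidiagonal_succ]
    simp only [Finset.HasAntidiagonal.antidiagonal_zero, Finset.sum_singleton, Nat.cast_zero,
      mul_zero, map_zero, zero_mul, add_zero, zero_add]
    refine Finset.sum_congr rfl fun k _ => Finset.sum_congr rfl fun α _ => ?_
    rw [multiPartialDeriv_partialDeriv_zero hu]
    congr 2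
    have : ((α.1 + 1).factorial : ℝ) = (α.1 + 1) * α.1.factorial := by
      rw [Nat.factorial_succ]; push_cast; ring
    rw [this]
    have h2 : (α.1.factorial : ℝ) ≠ 0 := by positivity
    have h3 : (α.2.factorial : ℝ) ≠ 0 := by positivity
    have h4 : (α.1 + 1 : ℝ) ≠ 0 := by positivity
    push_cast
    field_simp
  · simp only [Fin.mk_one, e1, hC]
    simp only [Finset.Nat.sum_antidiagonal_succ']
    simp only [Finset.HasAntidiagonal.antidiagonal_zero, Finset.sum_singleton, Nat.cast_zero,
      mul_zero, map_zero, zero_mul, add_zero, zero_add]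
    refine Finset.sum_congr rfl fun k _ => Finset.sum_congr rfl fun α _ => ?_
    rw [multiPartialDeriv_partialDeriv_one]
    congr 2
    have : ((α.2 + 1).factorial : ℝ) = (α.2 + 1) * α.2.factorial := by
      rw [Nat.factorial_succ]; push_cast; ring
    rw [this]
    have h2 : (α.1.factorial : ℝ) ≠ 0 := by positivity
    have h3 : (α.2.factorial : ℝ) ≠ 0 := by positivity
    have h4 : (α.2 + 1 : ℝ) ≠ 0 := by positivity
    push_cast
    field_simp

theorem taylorPoly_add (n : ℕ) {u v : Plane → ℝ} (hu : ContDiff ℝ ∞ u) (hv : ContDiff ℝ ∞ v)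
    (y : Plane) : taylorPoly n (u + v) y = taylorPoly n u y + taylorPoly n v y := by
  simp only [taylorPoly, multiPartialDeriv_add hu hv, Pi.add_apply, add_div, map_add, add_mul,
    Finset.sum_add_distrib]

theorem taylorPoly_eq_zero (n : ℕ) {u : Plane → ℝ} {y : Plane} (h : u =ᶠ[nhds y] fun _ => 0) :
    taylorPoly n u y = 0 := by
  refine Finset.sum_eq_zero fun k _ => Finset.sum_eq_zero fun α _ => ?_
  have := (multiPartialDeriv_eventuallyEq h α).eq_of_nhds
  rw [multiPartialDeriv_zero_fun] at this
  simp [this]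

/-- Taylor's formula with integral remainder along the segment from `y` to `x`. -/
theorem sub_eval_taylorPoly {u : Plane → ℝ} (hu : ContDiff ℝ ∞ u) (n : ℕ) (x y : Plane) :
    u x - MvPolynomial.eval (fun j => x j) (taylorPoly (n + 1) u y) =
      ∫ s in (0 : ℝ)..1, (1 - s) ^ n / n.factorial *
        directionalDeriv (n + 1) u (x - y) (y + s • (x - y)) := by
  have hf : ContDiff ℝ ∞ (fun s : ℝ => u (y + s • (x - y))) := by fun_prop
  have h := taylor_integral_remainder (f := fun s : ℝ => u (y + s • (x - y))) (x := 1) (x₀ := 0)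
    (n := n) (hf.of_le (by exact_mod_cast le_top)).contDiffOn
  have hw : ∀ (k : ℕ), ∀ s ∈ Set.uIcc (0 : ℝ) 1,
      iteratedDerivWithin k (fun s : ℝ => u (y + s • (x - y))) (Set.uIcc 0 1) s =
      directionalDeriv k u (x - y) (y + s • (x - y)) := by
    intro k s hs
    rw [iteratedDerivWithin_eq_iteratedDeriv (uniqueDiffOn_uIcc zero_ne_one)
      (hf.of_le (by exact_mod_cast le_top)).contDiffAt hs, iteratedDeriv_along_line hu]
  rw [taylor_within_apply] at h
  rw [eval_taylorPoly]
  convert! h using 1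
  · simp only [one_smul, add_sub_cancel, sub_zero, one_pow, mul_one, smul_eq_mul]
    congr 1
    refine Finset.sum_congr rfl fun k _ => ?_
    rw [hw k 0 (by simp), zero_smul, add_zero]
  · refine intervalIntegral.integral_congr fun s hs => ?_
    simp only [smul_eq_mul]
    rw [hw (n + 1) s hs]

/-! ### Integral averages over a ball -/

/-- The Cauchy–Schwarz inequality against the constant function `1`. -/
theorem sq_lintegral_le {β : Type*} [MeasurableSpace β] {μ : Measure β} {F : β → ℝ≥0∞}
    (hF : AEMeasurable F μ) : (∫⁻ x, F x ∂μ) ^ 2 ≤ μ Set.univ * ∫⁻ x, F x ^ 2 ∂μ := by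
  have h := ENNReal.lintegral_mul_le_Lp_mul_Lq μ (p := 2) (q := 2)
    (by constructor <;> norm_num) (f := fun _ => 1) (g := F) aemeasurable_const hF
  simp only [Pi.mul_apply, one_mul, ENNReal.one_rpow, lintegral_one] at h
  calc (∫⁻ x, F x ∂μ) ^ 2
      ≤ (μ Set.univ ^ (1 / 2 : ℝ) * (∫⁻ x, F x ^ (2 : ℝ) ∂μ) ^ (1 / 2 : ℝ)) ^ 2 := by
        gcongr
    _ = _ := by
        rw [mul_pow, ← ENNReal.rpow_natCast, ← ENNReal.rpow_natCast, ← ENNReal.rpow_mul,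
          ← ENNReal.rpow_mul]
        norm_num

/-- An affine substitution with ratio `a` in the plane has the Jacobian `a²`. -/
theorem setLIntegral_comp_affine_le {a : ℝ} (ha : a ≠ 0) (w : Plane) {S D : Set Plane}
    (hD : MeasurableSet D) (h : ∀ y ∈ S, a • y + w ∈ D) {G : Plane → ℝ≥0∞} (hG : Measurable G) :
    ∫⁻ y in S, G (a • y + w) ≤ (ENNReal.ofReal (a ^ 2))⁻¹ * ∫⁻ z in D, G z := by
  have hI : Measurable (D.indicator G) := hG.indicator hD
  calc ∫⁻ y in S, G (a • y + w) ≤ ∫⁻ y in S, D.indicator G (a • y + w) := by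
        refine setLIntegral_mono (hI.comp (by fun_prop)) fun y hy => ?_
        rw [Set.indicator_of_mem (h y hy)]
    _ ≤ ∫⁻ y, D.indicator G (a • y + w) := setLIntegral_le_lintegral _ _
    _ = ∫⁻ z, D.indicator G (z + w) ∂(Measure.map (a • ·) (volume : Measure Plane)) := by
        rw [lintegral_map (f := fun z => D.indicator G (z + w)) (hI.comp (by fun_prop))
          (by fun_prop)]
    _ = (ENNReal.ofReal (a ^ 2))⁻¹ * ∫⁻ z, D.indicator G (z + w) := by
        rw [Measure.map_addHaar_smul _ ha, lintegral_smul_measure, smul_eq_mul]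
        congr 1
        have h2 : 0 < a ^ 2 := by positivity
        rw [finrank_euclideanSpace, Fintype.card_fin, abs_of_pos (inv_pos.2 h2),
          ENNReal.ofReal_inv_of_pos h2]
    _ = (ENNReal.ofReal (a ^ 2))⁻¹ * ∫⁻ z in D, G z := by
        rw [lintegral_add_right_eq_self (D.indicator G) w, lintegral_indicator hD]

/-- For a fixed position `s` on the segments from `y ∈ B` to `x`, the substitution
`z = (1 - s) y + s x` costs the Jacobian `(1 - s)⁻²`, which the Cauchy–Schwarz inequality turns into
`(1 - s)⁻¹`; the weight `(1 - s)^n` with `n ≥ 1` absorbs it. -/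
theorem lintegral_segments_le {n : ℕ} (hn : 1 ≤ n) {B D : Set Plane} (hD : MeasurableSet D)
    {x : Plane} (h : ∀ y ∈ B, ∀ s ∈ Set.Ioo (0 : ℝ) 1, (1 - s) • y + s • x ∈ D)
    {F : Plane → ℝ≥0∞} (hF : Measurable F) :
    ∫⁻ y in B, ∫⁻ s in Set.Ioo (0 : ℝ) 1,
        ENNReal.ofReal ((1 - s) ^ n) * F ((1 - s) • y + s • x) ≤
      (volume B * ∫⁻ z in D, F z ^ 2) ^ (1 / 2 : ℝ) := by
  rw [lintegral_lintegral_swap (Measurable.aemeasurable (by unfold Function.uncurry; fun_prop))]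
  calc ∫⁻ s in Set.Ioo (0 : ℝ) 1, ∫⁻ y in B,
        ENNReal.ofReal ((1 - s) ^ n) * F ((1 - s) • y + s • x)
      ≤ ∫⁻ s in Set.Ioo (0 : ℝ) 1, (volume B * ∫⁻ z in D, F z ^ 2) ^ (1 / 2 : ℝ) := by
        refine setLIntegral_mono measurable_const fun s hs => ?_
        have hs1 : 0 < 1 - s := by linarith [hs.2]
        have hm : Measurable fun y : Plane => F ((1 - s) • y + s • x) := by fun_prop
        rw [lintegral_const_mul _ hm]
        have h1 := sq_lintegral_le (μ := volume.restrict B) hm.aemeasurable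
        have h2 := setLIntegral_comp_affine_le hs1.ne' (s • x) hD (fun y hy => h y hy s hs)
          (hF.pow_const 2)
        rw [Measure.restrict_apply_univ] at h1
        have h3 : (ENNReal.ofReal (1 - s) * ∫⁻ y in B, F ((1 - s) • y + s • x)) ^ 2 ≤
            volume B * ∫⁻ z in D, F z ^ 2 := by
          rw [mul_pow]
          calc ENNReal.ofReal (1 - s) ^ 2 * (∫⁻ y in B, F ((1 - s) • y + s • x)) ^ 2
              ≤ ENNReal.ofReal (1 - s) ^ 2 * (volume B *
                ((ENNReal.ofReal ((1 - s) ^ 2))⁻¹ * ∫⁻ z in D, F z ^ 2)) := by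
                gcongr
                exact h1.trans (by gcongr)
            _ = (ENNReal.ofReal (1 - s) ^ 2 * (ENNReal.ofReal ((1 - s) ^ 2))⁻¹) *
                (volume B * ∫⁻ z in D, F z ^ 2) := by ring
            _ = _ := by
                rw [ENNReal.ofReal_pow hs1.le, ENNReal.mul_inv_cancel, one_mul]
                · simpa using hs1
                · simp
        calc ENNReal.ofReal ((1 - s) ^ n) * ∫⁻ y in B, F ((1 - s) • y + s • x)
            ≤ ENNReal.ofReal (1 - s) * ∫⁻ y in B, F ((1 - s) • y + s • x) := by
              gcongr
              exact pow_le_of_le_one hs1.le (by linarith [hs.1]) (by omega)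
          _ = ((ENNReal.ofReal (1 - s) * ∫⁻ y in B, F ((1 - s) • y + s • x)) ^ 2) ^
                (1 / 2 : ℝ) := by
              rw [← ENNReal.rpow_natCast, ← ENNReal.rpow_mul]; norm_num
          _ ≤ _ := by gcongr
    _ = _ := by simp

/-- In the mean square over `x ∈ D` no singular weight is needed: for `s ≤ 1/2` the substitution is
made in `y`, for `s ≥ 1/2` in `x`. -/
theorem lintegral_sq_lintegral_segments_le {B D : Set Plane} (hD : MeasurableSet D)
    (h : ∀ x ∈ D, ∀ y ∈ B, ∀ s ∈ Set.Ioo (0 : ℝ) 1, (1 - s) • y + s • x ∈ D)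
    {F : Plane → ℝ≥0∞} (hF : Measurable F) :
    ∫⁻ x in D, (∫⁻ y in B, ∫⁻ s in Set.Ioo (0 : ℝ) 1, F ((1 - s) • y + s • x)) ^ 2 ≤
      volume B * (4 * (volume B + volume D) * ∫⁻ z in D, F z ^ 2) := by
  have hone : (volume.restrict (Set.Ioo (0 : ℝ) 1)) Set.univ = 1 := by simp
  calc ∫⁻ x in D, (∫⁻ y in B, ∫⁻ s in Set.Ioo (0 : ℝ) 1, F ((1 - s) • y + s • x)) ^ 2
      ≤ ∫⁻ x in D, volume B * ∫⁻ y in B, ∫⁻ s in Set.Ioo (0 : ℝ) 1,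
          F ((1 - s) • y + s • x) ^ 2 := by
        refine lintegral_mono fun x => ?_
        have h1 := sq_lintegral_le (μ := volume.restrict B)
          (F := fun y => ∫⁻ s in Set.Ioo (0 : ℝ) 1, F ((1 - s) • y + s • x))
          (Measurable.aemeasurable (Measurable.lintegral_prod_right (by fun_prop)))
        rw [Measure.restrict_apply_univ] at h1
        refine h1.trans ?_
        gcongr with y
        have h2 := sq_lintegral_le (μ := volume.restrict (Set.Ioo (0 : ℝ) 1))
          (F := fun s => F ((1 - s) • y + s • x)) (Measurable.aemeasurable (by fun_prop))
        rwa [hone, one_mul] at h2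
    _ = volume B * ∫⁻ x in D, ∫⁻ y in B, ∫⁻ s in Set.Ioo (0 : ℝ) 1,
          F ((1 - s) • y + s • x) ^ 2 := by
        rw [lintegral_const_mul]
        exact Measurable.lintegral_prod_right (Measurable.lintegral_prod_right (by fun_prop))
    _ = volume B * ∫⁻ s in Set.Ioo (0 : ℝ) 1, ∫⁻ x in D, ∫⁻ y in B,
          F ((1 - s) • y + s • x) ^ 2 := by
        congr 1
        refine (lintegral_congr fun x => lintegral_lintegral_swap
            (Measurable.aemeasurable (by unfold Function.uncurry; fun_prop))).trans ?_
        refine lintegral_lintegral_swap (Measurable.aemeasurable ?_)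
        unfold Function.uncurry
        exact Measurable.lintegral_prod_right (by fun_prop)
    _ ≤ volume B * ∫⁻ s in Set.Ioo (0 : ℝ) 1, 4 * (volume B + volume D) * ∫⁻ z in D, F z ^ 2 := by
        gcongr volume B * ?_
        refine setLIntegral_mono measurable_const fun s hs => ?_
        have hG : Measurable fun z => F z ^ 2 := hF.pow_const 2
        have hquarter : ∀ {t : ℝ}, 1 / 2 ≤ t → (ENNReal.ofReal (t ^ 2))⁻¹ ≤ 4 := by
          intro t ht
          rw [ENNReal.inv_le_iff_inv_le]
          have : (4 : ℝ≥0∞)⁻¹ = ENNReal.ofReal (1 / 4) := by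
            rw [one_div, ENNReal.ofReal_inv_of_pos (by norm_num)]; simp
          rw [this]
          exact ENNReal.ofReal_le_ofReal (by nlinarith)
        rcases le_total s (1 / 2) with hs2 | hs2
        · calc ∫⁻ x in D, ∫⁻ y in B, F ((1 - s) • y + s • x) ^ 2
              ≤ ∫⁻ x in D, 4 * ∫⁻ z in D, F z ^ 2 := by
                refine setLIntegral_mono measurable_const fun x hx => ?_
                refine (setLIntegral_comp_affine_le (a := 1 - s) (by linarith [hs.2]) (s • x) hD
                  (fun y hy => h x hx y hy s hs) hG).trans ?_
                gcongr
                exact hquarter (by linarith)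
            _ = 4 * volume D * ∫⁻ z in D, F z ^ 2 := by simp; ring
            _ ≤ _ := by gcongr; exact le_add_self
        · calc ∫⁻ x in D, ∫⁻ y in B, F ((1 - s) • y + s • x) ^ 2
              = ∫⁻ y in B, ∫⁻ x in D, F ((1 - s) • y + s • x) ^ 2 :=
                lintegral_lintegral_swap
                  (Measurable.aemeasurable (by unfold Function.uncurry; fun_prop))
            _ ≤ ∫⁻ y in B, 4 * ∫⁻ z in D, F z ^ 2 := by
                refine setLIntegral_mono measurable_const fun y hy => ?_
                have := (setLIntegral_comp_affine_le (a := s) (by linarith [hs.1]) ((1 - s) • y) hD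
                  (S := D) (fun x hx => by rw [add_comm]; exact h x hx y hy s hs) hG).trans
                  (mul_le_mul_left (hquarter (by linarith)) _)
                simpa only [add_comm] using this
            _ = 4 * volume B * ∫⁻ z in D, F z ^ 2 := by simp; ring
            _ ≤ _ := by gcongr; exact le_self_add
    _ = _ := by simp

/-! ### The averaged Taylor polynomial of a smooth function -/

theorem abs_directionalDeriv_le (k : ℕ) (u : Plane → ℝ) (v z : Plane) :
    |directionalDeriv k u v z| ≤ (2 * ‖v‖) ^ k *
      ∑ α ∈ Finset.HasAntidiagonal.antidiagonal k, |multiPartialDeriv α u z| := by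
  rw [directionalDeriv, Finset.mul_sum]
  refine (Finset.abs_sum_le_sum_abs _ _).trans (Finset.sum_le_sum fun α hα => ?_)
  have hk : α.1 + α.2 = k := Finset.HasAntidiagonal.mem_antidiagonal.1 hα
  have h1 : (k.choose α.1 : ℝ) ≤ 2 ^ k := by exact_mod_cast Nat.choose_le_two_pow k α.1
  have h2 : ∀ i, |v i| ≤ ‖v‖ := fun i => PiLp.norm_apply_le v i
  have h3 : |v 0| ^ α.1 * |v 1| ^ α.2 ≤ ‖v‖ ^ k := by
    rw [← hk, pow_add]
    gcongr
    · exact h2 0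
    · exact h2 1
  rw [abs_mul, abs_mul, abs_mul, abs_pow, abs_pow, Nat.abs_cast, mul_pow, ← mul_assoc]
  gcongr

/-- The sum of the absolute values of the derivatives of `u` of order `k`. -/
noncomputable def derivSum (k : ℕ) (u : Plane → ℝ) (z : Plane) : ℝ :=
  ∑ α ∈ Finset.HasAntidiagonal.antidiagonal k, |multiPartialDeriv α u z|

theorem continuous_derivSum (k : ℕ) {u : Plane → ℝ} (hu : ContDiff ℝ ∞ u) :
    Continuous (derivSum k u) :=
  continuous_finsetSum _ fun α _ => (hu.multiPartialDeriv α).continuous.abs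

theorem eLpNorm_derivSum_le (k : ℕ) {u : Plane → ℝ} (hu : ContDiff ℝ ∞ u) (μ : Measure Plane) :
    eLpNorm (derivSum k u) 2 μ ≤
      ∑ α ∈ Finset.HasAntidiagonal.antidiagonal k, eLpNorm (multiPartialDeriv α u) 2 μ := by
  have h := eLpNorm_sum_le (μ := μ) (p := 2) (s := Finset.HasAntidiagonal.antidiagonal k)
    (f := fun α z => |multiPartialDeriv α u z|)
    (fun α _ => (hu.multiPartialDeriv α).continuous.abs.aestronglyMeasurable) (by norm_num)
  have h2 : derivSum k u = ∑ α ∈ Finset.HasAntidiagonal.antidiagonal k,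
      fun z => |multiPartialDeriv α u z| := by
    funext z; simp [derivSum]
  rw [h2]
  refine h.trans (Finset.sum_le_sum fun α _ => le_of_eq ?_)
  exact eLpNorm_norm (multiPartialDeriv α u)

theorem enorm_sub_eval_taylorPoly_le {u : Plane → ℝ} (hu : ContDiff ℝ ∞ u) (n : ℕ) {x y : Plane}
    {d : ℝ} (hd : ‖x - y‖ ≤ d) :
    ‖u x - MvPolynomial.eval (fun j => x j) (taylorPoly (n + 1) u y)‖ₑ ≤
      ENNReal.ofReal ((2 * d) ^ (n + 1)) * ∫⁻ s in Set.Ioo (0 : ℝ) 1,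
        ENNReal.ofReal ((1 - s) ^ n) * ‖derivSum (n + 1) u ((1 - s) • y + s • x)‖ₑ := by
  have hm : Measurable fun s : ℝ =>
      ENNReal.ofReal ((1 - s) ^ n) * ‖derivSum (n + 1) u ((1 - s) • y + s • x)‖ₑ := by
    have := (continuous_derivSum (n + 1) hu).measurable
    fun_prop
  rw [sub_eval_taylorPoly hu, intervalIntegral.integral_of_le zero_le_one,
    integral_Ioc_eq_integral_Ioo, ← lintegral_const_mul _ hm]
  refine (enorm_integral_le_lintegral_enorm _).trans ?_
  refine setLIntegral_mono' measurableSet_Ioo fun s hs => ?_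
  have hp : y + s • (x - y) = (1 - s) • y + s • x := by module
  have hd0 : 0 ≤ d := (norm_nonneg _).trans hd
  have hs1 : 0 ≤ 1 - s := by linarith [hs.2]
  rw [hp, ← ofReal_norm, ← ofReal_norm, ← ENNReal.ofReal_mul (by positivity),
    ← ENNReal.ofReal_mul (by positivity)]
  refine ENNReal.ofReal_le_ofReal ?_
  have hF : 0 ≤ derivSum (n + 1) u ((1 - s) • y + s • x) :=
    Finset.sum_nonneg fun _ _ => abs_nonneg _
  rw [norm_mul, norm_div, norm_pow, Real.norm_of_nonneg hs1, Real.norm_of_nonneg hF,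
    Real.norm_eq_abs, Real.norm_eq_abs, Nat.abs_cast]
  have hfac : (1 : ℝ) ≤ n.factorial := by exact_mod_cast n.factorial_pos
  calc (1 - s) ^ n / n.factorial *
        |directionalDeriv (n + 1) u (x - y) ((1 - s) • y + s • x)|
      ≤ (1 - s) ^ n * ((2 * d) ^ (n + 1) * derivSum (n + 1) u ((1 - s) • y + s • x)) := by
        gcongr
        · exact div_le_self (by positivity) hfac
        · refine (abs_directionalDeriv_le _ _ _ _).trans ?_
          unfold derivSum at *
          gcongr
    _ = _ := by ring

theorem continuous_eval_taylorPoly {u : Plane → ℝ} (hu : ContDiff ℝ ∞ u) (n : ℕ) (x : Plane) :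
    Continuous fun y => MvPolynomial.eval (fun j => x j) (taylorPoly n u y) := by
  simp only [taylorPoly, centredMonomial, map_sum, map_mul, map_pow, map_sub, MvPolynomial.eval_C,
    MvPolynomial.eval_X]
  refine continuous_finsetSum _ fun k _ => continuous_finsetSum _ fun α _ => ?_
  have := (hu.multiPartialDeriv α).continuous
  fun_prop

theorem Continuous.integrableOn_ball {f : Plane → ℝ} (hf : Continuous f) (c : Plane) (r : ℝ) :
    IntegrableOn f (Metric.ball c r) :=
  (hf.continuousOn.integrableOn_compact (isCompact_closedBall c r)).mono_set
    Metric.ball_subset_closedBall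

theorem enorm_sub_average_le {c : Plane} {r : ℝ} (hr : 0 < r) (a : ℝ) {f : Plane → ℝ}
    (hf : Continuous f) :
    ‖a - ⨍ y in Metric.ball c r, f y‖ₑ ≤
      (volume (Metric.ball c r))⁻¹ * ∫⁻ y in Metric.ball c r, ‖a - f y‖ₑ := by
  have hv0 : volume (Metric.ball c r) ≠ 0 := (Metric.measure_ball_pos _ _ hr).ne'
  have hvt : volume (Metric.ball c r) ≠ ⊤ := measure_ball_lt_top.ne
  have h1 : a - ⨍ y in Metric.ball c r, f y = ⨍ y in Metric.ball c r, (a - f y) := by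
    rw [setAverage_eq, setAverage_eq, integral_sub (integrableOn_const (C := a) hvt (by simp))
      (hf.integrableOn_ball c r), setIntegral_const, smul_sub, smul_eq_mul, smul_eq_mul,
      smul_eq_mul, ← mul_assoc, inv_mul_cancel₀, one_mul]
    rw [measureReal_def]
    exact (ENNReal.toReal_pos hv0 hvt).ne'
  rw [h1, setAverage_eq, enorm_smul]
  refine mul_le_mul' (le_of_eq ?_) (enorm_integral_le_lintegral_enorm _)
  rw [measureReal_def, ← ENNReal.toReal_inv, Real.enorm_of_nonneg ENNReal.toReal_nonneg,
    ENNReal.ofReal_toReal (by simpa using hv0)]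

theorem eLpNorm_two_sq {E : Type*} [NormedAddCommGroup E] {β : Type*} [MeasurableSpace β]
    (f : β → E) (μ : Measure β) :
    eLpNorm f 2 μ ^ 2 = ∫⁻ x, ‖f x‖ₑ ^ 2 ∂μ := by
  have := eLpNorm_nnreal_pow_eq_lintegral (f := f) (μ := μ) (p := 2) (by norm_num)
  norm_num at this
  exact_mod_cast this

/-- The averaged Taylor polynomial of degree `n ≥ 1` approximates `u` uniformly. -/
theorem enorm_sub_average_taylorPoly_le {u : Plane → ℝ} (hu : ContDiff ℝ ∞ u) {n : ℕ} (hn : 1 ≤ n)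
    {c : Plane} {r d : ℝ} (hr : 0 < r) {D : Set Plane} (hD : MeasurableSet D) {x : Plane}
    (hseg : ∀ y ∈ Metric.ball c r, ∀ s ∈ Set.Ioo (0 : ℝ) 1, (1 - s) • y + s • x ∈ D)
    (hd : ∀ y ∈ Metric.ball c r, ‖x - y‖ ≤ d) :
    ‖u x - ⨍ y in Metric.ball c r,
        MvPolynomial.eval (fun j => x j) (taylorPoly (n + 1) u y)‖ₑ ≤
      ENNReal.ofReal ((2 * d) ^ (n + 1)) * (volume (Metric.ball c r) ^ (1 / 2 : ℝ))⁻¹ *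
        eLpNorm (derivSum (n + 1) u) 2 (volume.restrict D) := by
  have hv0 : volume (Metric.ball c r) ≠ 0 := (Metric.measure_ball_pos _ _ hr).ne'
  have hvt : volume (Metric.ball c r) ≠ ⊤ := measure_ball_lt_top.ne
  have hF' : Measurable (derivSum (n + 1) u) := (continuous_derivSum (n + 1) hu).measurable
  have hF : Measurable fun z => ‖derivSum (n + 1) u z‖ₑ := hF'.enorm
  refine (enorm_sub_average_le hr (u x) (continuous_eval_taylorPoly hu (n + 1) x)).trans ?_
  calc (volume (Metric.ball c r))⁻¹ * ∫⁻ y in Metric.ball c r,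
        ‖u x - MvPolynomial.eval (fun j => x j) (taylorPoly (n + 1) u y)‖ₑ
      ≤ (volume (Metric.ball c r))⁻¹ * ∫⁻ y in Metric.ball c r,
          ENNReal.ofReal ((2 * d) ^ (n + 1)) * ∫⁻ s in Set.Ioo (0 : ℝ) 1,
          ENNReal.ofReal ((1 - s) ^ n) * ‖derivSum (n + 1) u ((1 - s) • y + s • x)‖ₑ := by
        gcongr (volume (Metric.ball c r))⁻¹ * ?_
        exact setLIntegral_mono' measurableSet_ball fun y hy =>
          enorm_sub_eval_taylorPoly_le hu n (hd y hy)
    _ ≤ (volume (Metric.ball c r))⁻¹ * (ENNReal.ofReal ((2 * d) ^ (n + 1)) *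
          (volume (Metric.ball c r) * ∫⁻ z in D, ‖derivSum (n + 1) u z‖ₑ ^ 2) ^ (1 / 2 : ℝ)) := by
        rw [lintegral_const_mul]
        · gcongr
          exact lintegral_segments_le hn hD hseg hF
        · exact Measurable.lintegral_prod_right (by fun_prop)
    _ = _ := by
        rw [← eLpNorm_two_sq, ENNReal.mul_rpow_of_nonneg _ _ (by norm_num),
          ← ENNReal.rpow_natCast (eLpNorm _ _ _), ← ENNReal.rpow_mul]
        norm_num
        have : (volume (Metric.ball c r))⁻¹ * volume (Metric.ball c r) ^ (1 / 2 : ℝ) =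
            (volume (Metric.ball c r) ^ (1 / 2 : ℝ))⁻¹ := by
          rw [← ENNReal.rpow_neg_one, ← ENNReal.rpow_add _ _ hv0 hvt, ← ENNReal.rpow_neg]
          norm_num
        norm_num at this
        rw [← this]
        ring

/-- The averaged Taylor polynomial of any degree approximates `u` in the mean square. -/
theorem eLpNorm_sub_average_taylorPoly_le {u : Plane → ℝ} (hu : ContDiff ℝ ∞ u) (n : ℕ)
    {c : Plane} {r d : ℝ} (hr : 0 < r) {D : Set Plane} (hD : MeasurableSet D)
    (hseg : ∀ x ∈ D, ∀ y ∈ Metric.ball c r, ∀ s ∈ Set.Ioo (0 : ℝ) 1, (1 - s) • y + s • x ∈ D)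
    (hd : ∀ x ∈ D, ∀ y ∈ Metric.ball c r, ‖x - y‖ ≤ d) :
    eLpNorm (fun x => u x - ⨍ y in Metric.ball c r,
        MvPolynomial.eval (fun j => x j) (taylorPoly (n + 1) u y)) 2 (volume.restrict D) ≤
      ENNReal.ofReal ((2 * d) ^ (n + 1)) *
        (4 * (1 + volume D / volume (Metric.ball c r))) ^ (1 / 2 : ℝ) *
        eLpNorm (derivSum (n + 1) u) 2 (volume.restrict D) := by
  have hv0 : volume (Metric.ball c r) ≠ 0 := (Metric.measure_ball_pos _ _ hr).ne'
  have hvt : volume (Metric.ball c r) ≠ ⊤ := measure_ball_lt_top.ne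
  have hF' : Measurable (derivSum (n + 1) u) := (continuous_derivSum (n + 1) hu).measurable
  have hF : Measurable fun z => ‖derivSum (n + 1) u z‖ₑ := hF'.enorm
  rw [← ENNReal.pow_le_pow_left_iff two_ne_zero, eLpNorm_two_sq]
  have hpt : ∀ x ∈ D, ‖u x - ⨍ y in Metric.ball c r,
        MvPolynomial.eval (fun j => x j) (taylorPoly (n + 1) u y)‖ₑ ≤
      ((volume (Metric.ball c r))⁻¹ * ENNReal.ofReal ((2 * d) ^ (n + 1))) *
        ∫⁻ y in Metric.ball c r, ∫⁻ s in Set.Ioo (0 : ℝ) 1,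
          ‖derivSum (n + 1) u ((1 - s) • y + s • x)‖ₑ := by
    intro x hx
    refine (enorm_sub_average_le hr (u x) (continuous_eval_taylorPoly hu (n + 1) x)).trans ?_
    rw [mul_assoc, ← lintegral_const_mul (ENNReal.ofReal ((2 * d) ^ (n + 1)))]
    · gcongr (volume (Metric.ball c r))⁻¹ * ?_
      refine setLIntegral_mono' measurableSet_ball fun y hy => ?_
      refine (enorm_sub_eval_taylorPoly_le hu n (hd x hx y hy)).trans ?_
      gcongr ENNReal.ofReal ((2 * d) ^ (n + 1)) * ?_
      refine setLIntegral_mono' measurableSet_Ioo fun s hs => ?_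
      refine mul_le_of_le_one_left' ?_
      rw [ENNReal.ofReal_le_one]
      exact pow_le_one₀ (by linarith [hs.2]) (by linarith [hs.1])
    · exact Measurable.lintegral_prod_right (by fun_prop)
  calc ∫⁻ x in D, ‖u x - ⨍ y in Metric.ball c r,
        MvPolynomial.eval (fun j => x j) (taylorPoly (n + 1) u y)‖ₑ ^ 2
      ≤ ∫⁻ x in D, ((volume (Metric.ball c r))⁻¹ * ENNReal.ofReal ((2 * d) ^ (n + 1))) ^ 2 *
        (∫⁻ y in Metric.ball c r, ∫⁻ s in Set.Ioo (0 : ℝ) 1,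
          ‖derivSum (n + 1) u ((1 - s) • y + s • x)‖ₑ) ^ 2 := by
        refine setLIntegral_mono' hD fun x hx => ?_
        rw [← mul_pow]
        gcongr
        exact hpt x hx
    _ ≤ ((volume (Metric.ball c r))⁻¹ * ENNReal.ofReal ((2 * d) ^ (n + 1))) ^ 2 *
        (volume (Metric.ball c r) * (4 * (volume (Metric.ball c r) + volume D) *
          eLpNorm (derivSum (n + 1) u) 2 (volume.restrict D) ^ 2)) := by
        rw [lintegral_const_mul, eLpNorm_two_sq]
        · gcongr
          exact lintegral_sq_lintegral_segments_le hD hseg hF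
        · exact Measurable.pow_const (Measurable.lintegral_prod_right
            (Measurable.lintegral_prod_right (by fun_prop))) 2
    _ = _ := by
        have hinv : (volume (Metric.ball c r))⁻¹ * volume (Metric.ball c r) = 1 :=
          ENNReal.inv_mul_cancel hv0 hvt
        generalize ENNReal.ofReal ((2 * d) ^ (n + 1)) = A
        have hsq : ∀ b : ℝ≥0∞, (b ^ (1 / 2 : ℝ)) ^ 2 = b := fun b => by
          rw [← ENNReal.rpow_natCast, ← ENNReal.rpow_mul]; norm_num
        rw [mul_pow, mul_pow, mul_pow, hsq, div_eq_mul_inv]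
        calc _ = A ^ 2 *
              (4 * (((volume (Metric.ball c r))⁻¹ * volume (Metric.ball c r)) *
                ((volume (Metric.ball c r))⁻¹ * volume (Metric.ball c r)) +
                ((volume (Metric.ball c r))⁻¹ * volume (Metric.ball c r)) *
                (volume D * (volume (Metric.ball c r))⁻¹))) *
              eLpNorm (derivSum (n + 1) u) 2 (volume.restrict D) ^ 2 := by ring
          _ = _ := by rw [hinv, one_mul, one_mul]

/-! ### Finite-dimensional spaces with a separating set of functionals -/

section Separating

variable {V : Type*} [AddCommGroup V] [Module ℝ V] [FiniteDimensional ℝ V]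

theorem span_eq_top_of_separating {S : Set (Module.Dual ℝ V)}
    (hS : ∀ v, (∀ φ ∈ S, φ v = 0) → v = 0) : Submodule.span ℝ S = ⊤ := by
  have h : (Submodule.span ℝ S).dualCoannihilator = ⊥ := by
    rw [eq_bot_iff]
    intro v hv
    rw [Submodule.mem_dualCoannihilator] at hv
    exact hS v fun φ hφ => hv φ (Submodule.subset_span hφ)
  rw [← Subspace.dualCoannihilator_dualAnnihilator_eq (W := Submodule.span ℝ S), h,
    Submodule.dualAnnihilator_bot]

/-- Every functional is a combination of functionals from a separating set `S`, hence it is bounded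
by any common bound for `S`. -/
theorem exists_bound_of_separating {S : Set (Module.Dual ℝ V)}
    (hS : ∀ v, (∀ φ ∈ S, φ v = 0) → v = 0) (ℓ : Module.Dual ℝ V) :
    ∃ C : ℝ, 0 ≤ C ∧ ∀ (v : V) (B : ℝ), (∀ φ ∈ S, |φ v| ≤ B) → |ℓ v| ≤ C * B := by
  have hℓ : ℓ ∈ Submodule.span ℝ S := by rw [span_eq_top_of_separating hS]; trivial
  induction hℓ using Submodule.span_induction with
  | mem φ hφ => exact ⟨1, zero_le_one, fun v B h => by rw [one_mul]; exact h φ hφ⟩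
  | zero => exact ⟨0, le_rfl, fun v B h => by simp⟩
  | add ℓ₁ ℓ₂ _ _ h₁ h₂ =>
    obtain ⟨C₁, hC₁, h₁⟩ := h₁
    obtain ⟨C₂, hC₂, h₂⟩ := h₂
    refine ⟨C₁ + C₂, add_nonneg hC₁ hC₂, fun v B h => ?_⟩
    rw [LinearMap.add_apply, add_mul]
    exact (abs_add_le _ _).trans (add_le_add (h₁ v B h) (h₂ v B h))
  | smul a ℓ _ h =>
    obtain ⟨C, hC, h⟩ := h
    refine ⟨|a| * C, by positivity, fun v B hB => ?_⟩
    rw [LinearMap.smul_apply, smul_eq_mul, abs_mul, mul_assoc]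
    exact mul_le_mul_of_nonneg_left (h v B hB) (abs_nonneg a)

/-- A family in `V` that is integrable when tested against a separating set of functionals has an
integral in `V`. -/
theorem exists_integral_of_separating {S : Set (Module.Dual ℝ V)}
    (hS : ∀ v, (∀ φ ∈ S, φ v = 0) → v = 0) {β : Type*} [MeasurableSpace β] (μ : Measure β)
    (F : β → V) (hF : ∀ φ ∈ S, Integrable (fun y => φ (F y)) μ) :
    ∃ q : V, ∀ ℓ : Module.Dual ℝ V, ℓ q = ∫ y, ℓ (F y) ∂μ := by
  have hint : ∀ ℓ : Module.Dual ℝ V, Integrable (fun y => ℓ (F y)) μ := by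
    intro ℓ
    have hℓ : ℓ ∈ Submodule.span ℝ S := by rw [span_eq_top_of_separating hS]; trivial
    induction hℓ using Submodule.span_induction with
    | mem φ hφ => exact hF φ hφ
    | zero => simp
    | add ℓ₁ ℓ₂ _ _ h₁ h₂ => exact h₁.add h₂
    | smul a ℓ _ h => exact h.const_mul a
  let b := Module.finBasis ℝ V
  refine ⟨∑ j, (∫ y, b.coord j (F y) ∂μ) • b j, fun ℓ => ?_⟩
  simp only [map_sum, map_smul, smul_eq_mul]
  simp_rw [← integral_mul_const]
  rw [← integral_finsetSum _ fun j _ => (hint (b.coord j)).mul_const _]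
  refine integral_congr_ae (Filter.Eventually.of_forall fun y => ?_)
  change ∑ j, b.coord j (F y) * ℓ (b j) = ℓ (F y)
  conv_rhs => rw [← b.sum_repr (F y)]
  simp only [map_sum, map_smul, smul_eq_mul]
  rfl

end Separating

/-- The derivative at an end point of an interval is controlled by the values on the interval, since
these values separate the polynomials of bounded degree. -/
theorem exists_abs_derivative_zero_le (m : ℕ) :
    ∃ C : ℝ, 0 ≤ C ∧ ∀ f : Polynomial ℝ, f.natDegree ≤ m → ∀ B : ℝ,
      (∀ s ∈ Set.Icc (0 : ℝ) 1, |f.eval s| ≤ B) → |f.derivative.eval 0| ≤ C * B := by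
  let V := Polynomial.degreeLT ℝ (m + 1)
  have : FiniteDimensional ℝ V :=
    Module.Finite.equiv (Polynomial.degreeLTEquiv ℝ (m + 1)).symm
  let ev : ℝ → Module.Dual ℝ V := fun s => (Polynomial.leval s).comp V.subtype
  have hS : ∀ v : V, (∀ φ ∈ ev '' Set.Icc 0 1, φ v = 0) → v = 0 := by
    intro v hv
    apply Subtype.ext
    refine Polynomial.eq_zero_of_infinite_isRoot _ ((Set.Icc_infinite zero_lt_one).mono ?_)
    intro s hs
    exact hv (ev s) ⟨s, hs, rfl⟩
  obtain ⟨C, hC, h⟩ := exists_bound_of_separating hS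
    (((Polynomial.leval (0 : ℝ)).comp Polynomial.derivative).comp V.subtype)
  refine ⟨C, hC, fun f hf B hB => ?_⟩
  have hfV : f ∈ V := by
    rw [Polynomial.mem_degreeLT]
    exact (Polynomial.degree_le_natDegree).trans_lt (by exact_mod_cast Nat.lt_succ_of_le hf)
  refine h ⟨f, hfV⟩ B ?_
  rintro _ ⟨s, hs, rfl⟩
  exact hB s hs

/-! ### Solenoidal polynomial fields -/

/-- The solenoidal polynomial fields of degree at most `m` as a linear space. -/
def solenoidalSubmodule (m : ℕ) : Submodule ℝ PolyField where
  carrier := solenoidalPoly m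
  zero_mem' := ⟨fun i => by simp, by simp⟩
  add_mem' := by
    rintro p q ⟨hp, hp'⟩ ⟨hq, hq'⟩
    refine ⟨fun i => (MvPolynomial.totalDegree_add _ _).trans (max_le (hp i) (hq i)), ?_⟩
    simp only [Pi.add_apply, map_add, Finset.sum_add_distrib, hp', hq', add_zero]
  smul_mem' := by
    rintro a p ⟨hp, hp'⟩
    refine ⟨fun i => (MvPolynomial.totalDegree_smul_le a (p i)).trans (hp i), ?_⟩
    simp only [Pi.smul_apply, Derivation.map_smul, ← Finset.smul_sum, hp', smul_zero]

instance finiteDimensional_solenoidalSubmodule (m : ℕ) :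
    FiniteDimensional ℝ (solenoidalSubmodule m) := by
  let f : solenoidalSubmodule m →ₗ[ℝ]
      (Fin 2 → MvPolynomial.restrictTotalDegree (Fin 2) ℝ m) :=
    LinearMap.pi fun i => ((LinearMap.proj i).comp (solenoidalSubmodule m).subtype).codRestrict _
      fun p => (MvPolynomial.mem_restrictTotalDegree _ _ _).2 (p.2.1 i)
  refine Module.Finite.of_injective f fun p q h => ?_
  apply Subtype.ext
  funext i
  exact congrArg Subtype.val (congrFun h i)

/-- Evaluation of the `i`-th component of a polynomial field at `x`. -/
noncomputable def evalComponent (x : Plane) (i : Fin 2) : PolyField →ₗ[ℝ] ℝ :=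
  (MvPolynomial.aeval (fun j => x j) : MvPolynomial (Fin 2) ℝ →ₐ[ℝ] ℝ).toLinearMap.comp
    (LinearMap.proj i)

theorem evalComponent_apply (x : Plane) (i : Fin 2) (p : PolyField) :
    evalComponent x i p = p.toFun x i := by
  simp [evalComponent, PolyField.toFun, MvPolynomial.aeval_eq_eval]

theorem PolyField.toFun_apply (p : PolyField) (x : Plane) (i : Fin 2) :
    p.toFun x i = MvPolynomial.eval (fun j => x j) (p i) := rfl

theorem PolyField.toFun_sub (p q : PolyField) (x : Plane) :
    (p - q).toFun x = p.toFun x - q.toFun x := by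
  ext i
  simp [PolyField.toFun]

theorem continuous_eval_mvPolynomial (p : MvPolynomial (Fin 2) ℝ) :
    Continuous fun x : Plane => MvPolynomial.eval (fun j => x j) p := by
  have h := MvPolynomial.continuous_eval p
  have h2 : Continuous fun x : Plane => (fun j => x j : Fin 2 → ℝ) := by fun_prop
  exact h.comp h2

theorem PolyField.continuous_toFun (p : PolyField) : Continuous p.toFun := by
  unfold PolyField.toFun
  exact (PiLp.continuous_toLp 2 _).comp
    (continuous_pi fun i => continuous_eval_mvPolynomial (p i))

theorem mvPolynomial_eq_zero_of_isOpen {U : Set Plane} (hU : IsOpen U) (hne : U.Nonempty)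
    {p : MvPolynomial (Fin 2) ℝ} (h : ∀ x ∈ U, MvPolynomial.eval (fun j => x j) p = 0) :
    p = 0 := by
  obtain ⟨c, hc⟩ := hne
  have hU' : IsOpen (WithLp.toLp 2 ⁻¹' U : Set (Fin 2 → ℝ)) :=
    hU.preimage (PiLp.continuous_toLp 2 _)
  obtain ⟨ε, hε, hb⟩ := Metric.isOpen_iff.1 hU' (fun j => c j) hc
  refine MvPolynomial.funext_set (fun j => Metric.ball (c j) ε) (fun j => ?_) fun x hx => ?_
  · rw [Real.ball_eq_Ioo]
    exact Set.Ioo_infinite (by linarith)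
  · rw [map_zero]
    refine h (WithLp.toLp 2 x) (hb ?_)
    rw [← ball_pi _ hε] at hx
    exact hx

theorem PolyField.eq_zero_of_isOpen {U : Set Plane} (hU : IsOpen U) (hne : U.Nonempty)
    {p : PolyField} (h : ∀ x ∈ U, p.toFun x = 0) : p = 0 := by
  funext i
  refine mvPolynomial_eq_zero_of_isOpen hU hne fun x hx => ?_
  have := congrArg (fun v : Plane => v i) (h x hx)
  simpa [PolyField.toFun] using this

/-- On a bounded set, the values of the fields in `𝕊_m` are controlled by those on any set that
determines them. -/
theorem exists_norm_toFun_le (m : ℕ) {X D : Set Plane} (hD : Bornology.IsBounded D)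
    (hX : ∀ p ∈ solenoidalPoly m, (∀ x ∈ X, p.toFun x = 0) → p = 0) :
    ∃ C : ℝ, 0 ≤ C ∧ ∀ p ∈ solenoidalPoly m, ∀ B : ℝ, (∀ x ∈ X, ‖p.toFun x‖ ≤ B) →
      ∀ x ∈ D, ‖p.toFun x‖ ≤ C * B := by
  let V := solenoidalSubmodule m
  let S : Set (Module.Dual ℝ V) :=
    {φ | ∃ x ∈ X, ∃ i, φ = (evalComponent x i).comp V.subtype}
  have hS : ∀ v : V, (∀ φ ∈ S, φ v = 0) → v = 0 := by
    intro v hv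
    apply Subtype.ext
    refine hX v v.2 fun x hx => ?_
    ext i
    rw [← evalComponent_apply]
    exact hv _ ⟨x, hx, i, rfl⟩
  let b := Module.finBasis ℝ V
  choose C hC0 hC using fun j => exists_bound_of_separating hS (b.coord j)
  have hcomp : IsCompact (closure D) := hD.isCompact_closure
  have hM : ∀ j, ∃ M, ∀ x ∈ closure D, ‖(b j : PolyField).toFun x‖ ≤ M := fun j =>
    hcomp.exists_bound_of_continuousOn (PolyField.continuous_toFun _).continuousOn
  choose M hM using hM
  refine ⟨∑ j, C j * |M j|, Finset.sum_nonneg fun j _ => mul_nonneg (hC0 j) (abs_nonneg _),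
    fun p hp B hB x hx => ?_⟩
  have hco : ∀ j, |b.coord j ⟨p, hp⟩| ≤ C j * B := by
    refine fun j => hC j _ B ?_
    rintro _ ⟨x, hx, i, rfl⟩
    change |evalComponent x i p| ≤ B
    rw [evalComponent_apply]
    exact (PiLp.norm_apply_le (p.toFun x) i).trans (hB x hx)
  have hsum : p.toFun x = ∑ j, b.coord j ⟨p, hp⟩ • (b j : PolyField).toFun x := by
    ext i
    rw [← evalComponent_apply]
    have h1 : p = ∑ j, b.coord j ⟨p, hp⟩ • (b j : PolyField) := by
      have := congrArg Subtype.val (b.sum_repr ⟨p, hp⟩)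
      simp only [AddSubmonoidClass.coe_finsetSum, Submodule.coe_smul] at this
      exact this.symm
    conv_lhs => rw [h1]
    simp [map_sum, evalComponent_apply]
  rw [hsum, Finset.sum_mul]
  refine (norm_sum_le _ _).trans (Finset.sum_le_sum fun j _ => ?_)
  rw [norm_smul, Real.norm_eq_abs]
  calc |b.coord j ⟨p, hp⟩| * ‖(b j : PolyField).toFun x‖ ≤ (C j * B) * |M j| :=
        mul_le_mul (hco j) ((hM j x (subset_closure hx)).trans (le_abs_self _)) (norm_nonneg _)
          ((abs_nonneg _).trans (hco j))
    _ = _ := by ring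

/-! ### Solenoidal approximation of smooth solenoidal fields -/

theorem derivSum_partialDeriv_le (k : ℕ) {u : Plane → ℝ} (hu : ContDiff ℝ ∞ u) (j : Fin 2)
    (z : Plane) : derivSum k (partialDeriv j u) z ≤ derivSum (k + 1) u z := by
  unfold derivSum
  fin_cases j
  · simp only [Fin.zero_eta]
    rw [Finset.Nat.sum_antidiagonal_succ]
    refine le_add_of_nonneg_of_le (abs_nonneg _) (Finset.sum_le_sum fun α _ => ?_)
    rw [multiPartialDeriv_partialDeriv_zero hu]
  · simp only [Fin.mk_one]
    rw [Finset.Nat.sum_antidiagonal_succ']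
    refine le_add_of_nonneg_of_le (abs_nonneg _) (Finset.sum_le_sum fun α _ => ?_)
    rw [multiPartialDeriv_partialDeriv_one]

/-- If the divergence of a field vanishes near `y`, then so do its derivatives at `y`, which are the
coefficients of the divergence of the Taylor polynomials of the components. -/
theorem taylorPoly_mem_solenoidalPoly (m : ℕ) {u : Fin 2 → Plane → ℝ}
    (hu : ∀ i, ContDiff ℝ ∞ (u i)) {y : Plane}
    (hdiv : ∀ᶠ z in nhds y, ∑ i, partialDeriv i (u i) z = 0) :
    (fun i => taylorPoly (m + 1) (u i) y) ∈ solenoidalPoly m := by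
  refine ⟨fun i => totalDegree_taylorPoly_le m (u i) y, ?_⟩
  rw [Fin.sum_univ_two, pderiv_taylorPoly m (hu 0), pderiv_taylorPoly m (hu 1),
    ← taylorPoly_add m ((hu 0).partialDeriv 0) ((hu 1).partialDeriv 1)]
  refine taylorPoly_eq_zero m ?_
  filter_upwards [hdiv] with z hz
  rw [Fin.sum_univ_two] at hz
  exact hz

/-- Evaluation of the `j`-th derivative of the `i`-th component of a polynomial field at `x`. -/
noncomputable def evalPderiv (x : Plane) (j i : Fin 2) : PolyField →ₗ[ℝ] ℝ :=
  (MvPolynomial.aeval (fun k => x k) : MvPolynomial (Fin 2) ℝ →ₐ[ℝ] ℝ).toLinearMap.comp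
    ((MvPolynomial.pderiv j).toLinearMap.comp (LinearMap.proj i))

theorem evalPderiv_apply (x : Plane) (j i : Fin 2) (p : PolyField) :
    evalPderiv x j i p = MvPolynomial.eval (fun k => x k) (MvPolynomial.pderiv j (p i)) := by
  simp [evalPderiv, MvPolynomial.aeval_eq_eval]

/-- The average over a ball of the Taylor polynomials of a solenoidal field is solenoidal. -/
theorem exists_average_taylorPoly (m : ℕ) {u : Fin 2 → Plane → ℝ}
    (hu : ∀ i, ContDiff ℝ ∞ (u i)) {c : Plane} {r : ℝ} (hr : 0 < r)
    (hdiv : ∀ y ∈ Metric.ball c r, ∑ i, partialDeriv i (u i) y = 0) :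
    ∃ q ∈ solenoidalPoly m,
      (∀ x i, q.toFun x i = ⨍ y in Metric.ball c r,
        MvPolynomial.eval (fun k => x k) (taylorPoly (m + 1) (u i) y)) ∧
      (∀ (x : Plane) (j i : Fin 2), MvPolynomial.eval (fun k => x k) (MvPolynomial.pderiv j (q i)) =
        ⨍ y in Metric.ball c r,
          MvPolynomial.eval (fun k => x k) (taylorPoly m (partialDeriv j (u i)) y)) := by
  classical
  let V := solenoidalSubmodule m
  have hmem : ∀ y ∈ Metric.ball c r, (fun i => taylorPoly (m + 1) (u i) y) ∈ V := fun y hy =>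
    taylorPoly_mem_solenoidalPoly m hu
      (Filter.eventually_of_mem (Metric.isOpen_ball.mem_nhds hy) hdiv)
  -- The value outside the ball is irrelevant; it makes the family `V`-valued everywhere.
  let F : Plane → V := fun y =>
    if hy : y ∈ Metric.ball c r then ⟨_, hmem y hy⟩ else 0
  have hFc : ∀ y ∈ Metric.ball c r, (F y : PolyField) = fun i => taylorPoly (m + 1) (u i) y := by
    intro y hy
    simp only [F, dif_pos hy]
  let S : Set (Module.Dual ℝ V) := {φ | ∃ x i, φ = (evalComponent x i).comp V.subtype}
  have hS : ∀ v : V, (∀ φ ∈ S, φ v = 0) → v = 0 := by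
    intro v hv
    apply Subtype.ext
    refine PolyField.eq_zero_of_isOpen isOpen_univ Set.univ_nonempty fun x _ => ?_
    ext i
    rw [← evalComponent_apply]
    exact hv _ ⟨x, i, rfl⟩
  let μ : Measure Plane :=
    ((volume.restrict (Metric.ball c r)) Set.univ)⁻¹ • volume.restrict (Metric.ball c r)
  have hae : ∀ᵐ y ∂μ, y ∈ Metric.ball c r :=
    Measure.ae_smul_measure (ae_restrict_mem measurableSet_ball) _
  have hF : ∀ φ ∈ S, Integrable (fun y => φ (F y)) μ := by
    rintro _ ⟨x, i, rfl⟩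
    have h1 : Integrable
        (fun y => MvPolynomial.eval (fun k => x k) (taylorPoly (m + 1) (u i) y)) μ := by
      refine Integrable.smul_measure
        ((continuous_eval_taylorPoly (hu i) (m + 1) x).integrableOn_ball c r) ?_
      rw [Measure.restrict_apply_univ]
      exact ENNReal.inv_ne_top.2 (Metric.measure_ball_pos _ _ hr).ne'
    refine h1.congr ?_
    filter_upwards [hae] with y hy
    change _ = evalComponent x i (F y : PolyField)
    rw [hFc y hy, evalComponent_apply, PolyField.toFun_apply]
  obtain ⟨q, hq⟩ := exists_integral_of_separating hS μ F hF
  refine ⟨q, q.2, fun x i => ?_, fun x j i => ?_⟩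
  · have h := hq ((evalComponent x i).comp V.subtype)
    rw [← evalComponent_apply]
    refine h.trans (integral_congr_ae ?_)
    filter_upwards [hae] with y hy
    change evalComponent x i (F y : PolyField) = _
    rw [hFc y hy, evalComponent_apply, PolyField.toFun_apply]
  · have h := hq ((evalPderiv x j i).comp V.subtype)
    rw [← evalPderiv_apply]
    refine h.trans (integral_congr_ae ?_)
    filter_upwards [hae] with y hy
    change evalPderiv x j i (F y : PolyField) = _
    rw [hFc y hy, evalPderiv_apply, pderiv_taylorPoly m (hu i)]

/-- The area of the unit disc. -/
noncomputable def discArea : ℝ := (volume (Metric.ball (0 : Plane) 1)).toReal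

theorem discArea_pos : 0 < discArea :=
  ENNReal.toReal_pos (Metric.measure_ball_pos _ _ one_pos).ne' measure_ball_lt_top.ne

theorem volume_ball_plane (c : Plane) (r : ℝ) (hr : 0 ≤ r) :
    volume (Metric.ball c r) = ENNReal.ofReal (r ^ 2 * discArea) := by
  rw [Measure.addHaar_ball _ _ hr, finrank_euclideanSpace, Fintype.card_fin, discArea,
    ENNReal.ofReal_mul (by positivity), ENNReal.ofReal_toReal measure_ball_lt_top.ne]

theorem volume_closedBall_plane (c : Plane) (r : ℝ) (hr : 0 ≤ r) :
    volume (Metric.closedBall c r) = ENNReal.ofReal (r ^ 2 * discArea) := by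
  rw [Measure.addHaar_closedBall _ _ hr, finrank_euclideanSpace, Fintype.card_fin, discArea,
    ENNReal.ofReal_mul (by positivity), ENNReal.ofReal_toReal measure_ball_lt_top.ne]

/-- A smooth solenoidal field on a set that is star-shaped with respect to a ball is approximated
by a solenoidal polynomial field, uniformly and, for the gradients, in the mean square. The uniform
bound requires two derivatives, that is `1 ≤ m`. -/
theorem exists_solenoidal_approx (m : ℕ) (hm : 1 ≤ m) (γ : ℝ) :
    ∃ C : ℝ≥0, ∀ (u : Fin 2 → Plane → ℝ), (∀ i, ContDiff ℝ ∞ (u i)) →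
      ∀ (c : Plane) (r d : ℝ) (D : Set Plane), 0 < r → d ≤ γ * r → MeasurableSet D → c ∈ D →
      (∀ x ∈ D, ∀ y ∈ Metric.ball c r, ∀ s ∈ Set.Ioo (0 : ℝ) 1, (1 - s) • y + s • x ∈ D) →
      (∀ x ∈ D, ∀ y ∈ Metric.ball c r, ‖x - y‖ ≤ d) →
      (∀ y ∈ Metric.ball c r, ∑ i, partialDeriv i (u i) y = 0) →
      ∃ q ∈ solenoidalPoly m,
        (∀ x ∈ D, ∀ i, ‖u i x - q.toFun x i‖ₑ ≤ C * ENNReal.ofReal (d ^ m) *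
          ∑ α ∈ Finset.HasAntidiagonal.antidiagonal (m + 1),
            eLpNorm (multiPartialDeriv α (u i)) 2 (volume.restrict D)) ∧
        (∀ j i, eLpNorm (fun x => partialDeriv j (u i) x -
            MvPolynomial.eval (fun k => x k) (MvPolynomial.pderiv j (q i))) 2
            (volume.restrict D) ≤ C * ENNReal.ofReal (d ^ m) *
          ∑ α ∈ Finset.HasAntidiagonal.antidiagonal (m + 1),
            eLpNorm (multiPartialDeriv α (u i)) 2 (volume.restrict D)) := by
  -- `A` serves the uniform bound, where `d / r ≤ γ` removes the radius from
  -- `d ^ (m + 1) / |B(c, r)| ^ (1 / 2)`; `B` serves the gradients, where the ratio of the areas of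
  -- `D` and of the ball is at most `γ ^ 2`.
  set A : ℝ := 2 ^ (m + 1) * γ / Real.sqrt discArea with hA
  set B : ℝ := 2 ^ m * Real.sqrt (4 * (1 + γ ^ 2)) with hB
  refine ⟨Real.toNNReal (max A B), fun u hu c r d D hr hdr hD hcD hseg hd hdiv => ?_⟩
  obtain ⟨q, hq, hq1, hq2⟩ := exists_average_taylorPoly m hu hr hdiv
  have hd0 : 0 ≤ d := by simpa using hd c hcD c (Metric.mem_ball_self hr)
  have hvol := volume_ball_plane c r hr.le
  have hda := discArea_pos
  have hγ : 0 ≤ γ := nonneg_of_mul_nonneg_left (hd0.trans hdr) hr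
  refine ⟨q, hq, fun x hx i => ?_, fun j i => ?_⟩
  · rw [hq1]
    refine (enorm_sub_average_taylorPoly_le (hu i) hm hr hD (hseg x hx) (hd x hx)).trans ?_
    refine mul_le_mul' ?_ (eLpNorm_derivSum_le (m + 1) (hu i) _)
    have h1 : volume (Metric.ball c r) ^ (1 / 2 : ℝ) =
        ENNReal.ofReal (r * Real.sqrt discArea) := by
      rw [hvol, ENNReal.ofReal_rpow_of_nonneg (by positivity) (by norm_num), ← Real.sqrt_eq_rpow,
        Real.sqrt_mul (by positivity), Real.sqrt_sq hr.le]
    have h2 : 0 < r * Real.sqrt discArea := by positivity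
    rw [h1, ← ENNReal.ofReal_inv_of_pos h2, ← ENNReal.ofReal_mul (by positivity),
      ← ENNReal.ofReal_coe_nnreal, ← ENNReal.ofReal_mul (by positivity)]
    refine ENNReal.ofReal_le_ofReal ?_
    calc (2 * d) ^ (m + 1) * (r * Real.sqrt discArea)⁻¹
        = 2 ^ (m + 1) * (d / r) / Real.sqrt discArea * d ^ m := by
          field_simp
          ring
      _ ≤ A * d ^ m := by
          have : d / r ≤ γ := (div_le_iff₀ hr).2 hdr
          rw [hA]
          gcongr
      _ ≤ _ := by
          gcongr
          exact (le_max_left _ _).trans (Real.le_coe_toNNReal _)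
  · have hfun : (fun x => partialDeriv j (u i) x -
        MvPolynomial.eval (fun k => x k) (MvPolynomial.pderiv j (q i))) = fun x =>
        partialDeriv j (u i) x - ⨍ y in Metric.ball c r,
          MvPolynomial.eval (fun k => x k) (taylorPoly (m - 1 + 1) (partialDeriv j (u i)) y) := by
      funext x
      rw [hq2, Nat.sub_add_cancel hm]
    rw [hfun]
    refine (eLpNorm_sub_average_taylorPoly_le ((hu i).partialDeriv j) (m - 1) hr hD hseg
      hd).trans ?_
    rw [Nat.sub_add_cancel hm]
    refine mul_le_mul' ?_ ?_
    · have hDv : volume D / volume (Metric.ball c r) ≤ ENNReal.ofReal (γ ^ 2) := by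
        have hsub : D ⊆ Metric.closedBall c d := fun x hx => by
          rw [Metric.mem_closedBall, dist_eq_norm]
          exact hd x hx c (Metric.mem_ball_self hr)
        refine ENNReal.div_le_of_le_mul ((measure_mono hsub).trans ?_)
        rw [volume_closedBall_plane c d hd0, hvol, ← ENNReal.ofReal_mul (by positivity)]
        refine ENNReal.ofReal_le_ofReal ?_
        calc d ^ 2 * discArea ≤ (γ * r) ^ 2 * discArea := by gcongr
          _ = _ := by ring
      have h4 : (4 * (1 + volume D / volume (Metric.ball c r))) ^ (1 / 2 : ℝ) ≤
          ENNReal.ofReal (Real.sqrt (4 * (1 + γ ^ 2))) := by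
        rw [Real.sqrt_eq_rpow, ← ENNReal.ofReal_rpow_of_nonneg (by positivity) (by norm_num),
          ENNReal.ofReal_mul (by norm_num), ENNReal.ofReal_add (by norm_num) (by positivity)]
        gcongr
        · norm_num
        · norm_num
      calc _ ≤ ENNReal.ofReal ((2 * d) ^ m) * ENNReal.ofReal (Real.sqrt (4 * (1 + γ ^ 2))) := by
            gcongr
        _ = ENNReal.ofReal (B * d ^ m) := by
            rw [← ENNReal.ofReal_mul (by positivity), hB, mul_pow]
            congr 1
            ring
        _ ≤ _ := by
            rw [← ENNReal.ofReal_coe_nnreal, ← ENNReal.ofReal_mul (by positivity)]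
            gcongr
            exact (le_max_right _ _).trans (Real.le_coe_toNNReal _)
    · refine le_trans (eLpNorm_mono_real fun z => ?_) (eLpNorm_derivSum_le (m + 1) (hu i) _)
      have h0 : 0 ≤ derivSum m (partialDeriv j (u i)) z :=
        Finset.sum_nonneg fun _ _ => abs_nonneg _
      rw [Real.norm_of_nonneg h0]
      exact derivSum_partialDeriv_le m (hu i) j z

/-! ### Mollification and weak derivatives -/

/-- The convolution `ψ * (1_D f)`. -/
noncomputable def convOn (ψ : Plane → ℝ) (D : Set Plane) (f : Plane → ℝ) : Plane → ℝ :=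
  fun x => ∫ y in D, ψ (x - y) * f y

theorem convOn_eq_convolution (ψ : Plane → ℝ) {D : Set Plane} (hD : MeasurableSet D)
    (f : Plane → ℝ) :
    convOn ψ D f = convolution ψ (D.indicator f) (ContinuousLinearMap.lsmul ℝ ℝ) volume := by
  funext x
  rw [convolution_lsmul_swap, convOn, ← integral_indicator hD]
  refine integral_congr_ae (Filter.Eventually.of_forall fun y => ?_)
  by_cases hy : y ∈ D <;> simp [hy]

section

variable {ψ f w : Plane → ℝ} {D : Set Plane}

theorem locallyIntegrable_indicator (hD : MeasurableSet D) (hf : IntegrableOn f D) :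
    LocallyIntegrable (D.indicator f) :=
  ((integrable_indicator_iff hD).2 hf).locallyIntegrable

theorem contDiff_convOn (hψ : ContDiff ℝ ∞ ψ) (hc : HasCompactSupport ψ) (hD : MeasurableSet D)
    (hf : IntegrableOn f D) : ContDiff ℝ ∞ (convOn ψ D f) := by
  rw [convOn_eq_convolution ψ hD]
  exact hc.contDiff_convolution_left _ hψ (locallyIntegrable_indicator hD hf)

theorem HasCompactSupport.partialDeriv (hc : HasCompactSupport ψ) (i : Fin 2) :
    HasCompactSupport (partialDeriv i ψ) :=
  hc.fderiv_apply (𝕜 := ℝ) _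

theorem HasCompactSupport.iterate_partialDeriv (hc : HasCompactSupport ψ) (i : Fin 2) (k : ℕ) :
    HasCompactSupport ((_root_.partialDeriv i)^[k] ψ) := by
  induction k with
  | zero => exact hc
  | succ k ih => rw [Function.iterate_succ_apply']; exact ih.partialDeriv i

theorem partialDeriv_convOn (hψ : ContDiff ℝ ∞ ψ) (hc : HasCompactSupport ψ)
    (hD : MeasurableSet D) (hf : IntegrableOn f D) (i : Fin 2) :
    partialDeriv i (convOn ψ D f) = convOn (partialDeriv i ψ) D f := by
  have hli := locallyIntegrable_indicator hD hf
  have hψ1 : ContDiff ℝ 1 ψ := hψ.of_le (by exact_mod_cast le_top)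
  funext x
  rw [convOn_eq_convolution ψ hD, convOn_eq_convolution _ hD]
  have h := hc.hasFDerivAt_convolution_left (ContinuousLinearMap.lsmul ℝ ℝ) hψ1 hli x
  rw [partialDeriv, h.fderiv]
  have hex := (hc.fderiv ℝ).convolutionExists_left
    ((ContinuousLinearMap.lsmul ℝ ℝ : ℝ →L[ℝ] ℝ →L[ℝ] ℝ).precompL Plane)
    (hψ1.continuous_fderiv one_ne_zero) hli x
  rw [convolution_def, ContinuousLinearMap.integral_apply hex]
  rfl

theorem iterate_partialDeriv_convOn (hψ : ContDiff ℝ ∞ ψ) (hc : HasCompactSupport ψ)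
    (hD : MeasurableSet D) (hf : IntegrableOn f D) (i : Fin 2) (k : ℕ) :
    (partialDeriv i)^[k] (convOn ψ D f) = convOn ((partialDeriv i)^[k] ψ) D f := by
  induction k with
  | zero => rfl
  | succ k ih =>
    rw [Function.iterate_succ_apply', ih, Function.iterate_succ_apply',
      partialDeriv_convOn (hψ.iterate_partialDeriv i k) (hc.iterate_partialDeriv i k) hD hf]

theorem multiPartialDeriv_convOn (hψ : ContDiff ℝ ∞ ψ) (hc : HasCompactSupport ψ)
    (hD : MeasurableSet D) (hf : IntegrableOn f D) (α : ℕ × ℕ) :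
    multiPartialDeriv α (convOn ψ D f) = convOn (multiPartialDeriv α ψ) D f := by
  simp only [multiPartialDeriv]
  rw [iterate_partialDeriv_convOn hψ hc hD hf, iterate_partialDeriv_convOn
    (hψ.iterate_partialDeriv 1 _) (hc.iterate_partialDeriv 1 _) hD hf]

theorem partialDeriv_const_mul_reflect (hψ : ContDiff ℝ ∞ ψ) (a : ℝ) (x : Plane) (i : Fin 2) :
    partialDeriv i (fun y => a * ψ (x - y)) = fun y => -a * partialDeriv i ψ (x - y) := by
  funext y
  have h1 : HasFDerivAt (fun y : Plane => x - y) (-ContinuousLinearMap.id ℝ Plane) y :=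
    (hasFDerivAt_id y).const_sub x
  have h2 := (((hψ.differentiable (by simp)) (x - y)).hasFDerivAt.comp y h1).const_mul a
  rw [partialDeriv]
  erw [h2.fderiv]
  simp [partialDeriv]

theorem iterate_partialDeriv_reflect (hψ : ContDiff ℝ ∞ ψ) (a : ℝ) (x : Plane) (i : Fin 2)
    (k : ℕ) : (partialDeriv i)^[k] (fun y => a * ψ (x - y)) =
      fun y => (-1) ^ k * a * (partialDeriv i)^[k] ψ (x - y) := by
  induction k with
  | zero => simp
  | succ k ih =>
    rw [Function.iterate_succ_apply', ih,
      partialDeriv_const_mul_reflect (hψ.iterate_partialDeriv i k), Function.iterate_succ_apply']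
    funext y
    ring

theorem multiPartialDeriv_reflect (hψ : ContDiff ℝ ∞ ψ) (x : Plane) (α : ℕ × ℕ) :
    multiPartialDeriv α (fun y => ψ (x - y)) =
      fun y => (-1) ^ (α.1 + α.2) * multiPartialDeriv α ψ (x - y) := by
  have h1 := iterate_partialDeriv_reflect hψ 1 x 1 α.2
  simp only [one_mul, mul_one] at h1
  simp only [multiPartialDeriv]
  rw [h1, iterate_partialDeriv_reflect (hψ.iterate_partialDeriv 1 _)]
  funext y
  ring

/-- The reflected translates of a mollifier are test functions away from the boundary. -/
theorem isTestFunction_reflect (hψ : ContDiff ℝ ∞ ψ) {ε : ℝ}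
    (hs : tsupport ψ ⊆ Metric.closedBall 0 ε) {x : Plane} (hx : Metric.closedBall x ε ⊆ D) :
    IsTestFunction D (fun y => ψ (x - y)) := by
  have hsub : tsupport (fun y => ψ (x - y)) ⊆ Metric.closedBall x ε := by
    refine closure_minimal (fun y hy => ?_) Metric.isClosed_closedBall
    have := hs (subset_tsupport ψ (Function.mem_support.2 (Function.mem_support.1 hy)))
    rwa [mem_closedBall_zero_iff, ← dist_eq_norm, dist_comm] at this
  refine ⟨by fun_prop, ?_, hsub.trans hx⟩
  exact (isCompact_closedBall x ε).of_isClosed_subset (isClosed_tsupport _) hsub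

/-- Away from the boundary, mollification commutes with weak differentiation. -/
theorem multiPartialDeriv_convOn_eq (hψ : ContDiff ℝ ∞ ψ) (hc : HasCompactSupport ψ) {ε : ℝ}
    (hs : tsupport ψ ⊆ Metric.closedBall 0 ε) (hD : MeasurableSet D) (hf : IntegrableOn f D)
    {α : ℕ × ℕ} (hw : IsWeakDeriv D α f w) {x : Plane} (hx : Metric.closedBall x ε ⊆ D) :
    multiPartialDeriv α (convOn ψ D f) x = convOn ψ D w x := by
  have h := hw.2.2 _ (isTestFunction_reflect hψ hs hx)
  rw [multiPartialDeriv_convOn hψ hc hD hf, convOn, convOn]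
  rw [multiPartialDeriv_reflect hψ] at h
  have h1 : ∫ y in D, f y * ((-1) ^ (α.1 + α.2) * multiPartialDeriv α ψ (x - y)) =
      (-1) ^ (α.1 + α.2) * ∫ y in D, multiPartialDeriv α ψ (x - y) * f y := by
    rw [← integral_const_mul]
    congr 1
    funext y
    ring
  rw [h1] at h
  have h2 := mul_left_cancel₀ (pow_ne_zero _ (by norm_num)) h
  rw [h2]
  congr 1
  funext y
  ring

/-- Away from the boundary, a mollified weakly solenoidal field is solenoidal. -/
theorem sum_partialDeriv_convOn_eq_zero (hψ : ContDiff ℝ ∞ ψ) (hc : HasCompactSupport ψ) {ε : ℝ}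
    (hs : tsupport ψ ⊆ Metric.closedBall 0 ε) (hD : MeasurableSet D) {g : Plane → Plane}
    (hg : ∀ i, IntegrableOn (fun y => g y i) D) (hdiv : WeaklyDivFree D g) {x : Plane}
    (hx : Metric.closedBall x ε ⊆ D) :
    ∑ i, partialDeriv i (convOn ψ D fun y => g y i) x = 0 := by
  have h := hdiv _ (isTestFunction_reflect hψ hs hx)
  have hp : ∀ i y, partialDeriv i (fun y => ψ (x - y)) y = -partialDeriv i ψ (x - y) := by
    intro i y
    have := congrFun (partialDeriv_const_mul_reflect hψ 1 x i) y
    simpa using this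
  simp_rw [hp] at h
  have hint : ∀ i, Integrable (fun y => partialDeriv i ψ (x - y) * g y i) (volume.restrict D) := by
    intro i
    have hcont := (hψ.partialDeriv i).continuous
    obtain ⟨M, hM⟩ := hcont.bounded_above_of_compact_support (hc.partialDeriv i)
    exact (hg i).bdd_mul (by fun_prop) (Filter.Eventually.of_forall fun y => hM (x - y))
  simp_rw [partialDeriv_convOn hψ hc hD (hg _), convOn]
  rw [← integral_finsetSum _ fun i _ => hint i, ← neg_eq_zero, ← integral_neg]
  refine Eq.trans (integral_congr_ae (Filter.Eventually.of_forall fun y => ?_)) h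
  simp only [← Finset.sum_neg_distrib]
  refine Finset.sum_congr rfl fun i _ => ?_
  ring

/-- Mollification does not increase the `L²` norm. -/
theorem eLpNorm_convOn_le (φ : ContDiffBump (0 : Plane))
    (hw : AEStronglyMeasurable w (volume.restrict D)) :
    eLpNorm (convOn (φ.normed volume) D w) 2 volume ≤ eLpNorm w 2 (volume.restrict D) := by
  rw [← ENNReal.pow_le_pow_left_iff two_ne_zero, eLpNorm_two_sq, eLpNorm_two_sq]
  set ψ := φ.normed (volume : Measure Plane) with hψ
  have hψm : Measurable ψ := φ.continuous_normed.measurable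
  have hone : ∀ (T : Plane → Plane), (∫⁻ y, ‖ψ (T y)‖ₑ = ∫⁻ y, ‖ψ y‖ₑ) →
      ∫⁻ y, ‖ψ (T y)‖ₑ = 1 := by
    intro T hT
    rw [hT, ← ofReal_integral_norm_eq_lintegral_enorm φ.integrable_normed]
    simp_rw [Real.norm_of_nonneg (φ.nonneg_normed _)]
    rw [φ.integral_normed, ENNReal.ofReal_one]
  have hw' : AEMeasurable (fun y => ‖w y‖ₑ) (volume.restrict D) := hw.enorm
  calc ∫⁻ x, ‖convOn ψ D w x‖ₑ ^ 2
      ≤ ∫⁻ x, ∫⁻ y in D, ‖ψ (x - y)‖ₑ * ‖w y‖ₑ ^ 2 := by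
        refine lintegral_mono fun x => ?_
        have hkm : Measurable fun y => ‖ψ (x - y)‖ₑ := by fun_prop
        -- The Cauchy–Schwarz inequality for a measure `ν` of total mass at most one.
        let ν := (volume.restrict D).withDensity fun y => ‖ψ (x - y)‖ₑ
        have hac : ν ≪ volume.restrict D := withDensity_absolutelyContinuous _ _
        have h1 := sq_lintegral_le (μ := ν) (hw'.mono_ac hac)
        rw [lintegral_withDensity_eq_lintegral_mul₀ hkm.aemeasurable hw',
          lintegral_withDensity_eq_lintegral_mul₀ hkm.aemeasurable (hw'.pow_const 2)] at h1
        have h2 : ν Set.univ ≤ 1 := by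
          rw [withDensity_apply _ MeasurableSet.univ, Measure.restrict_univ]
          refine (setLIntegral_le_lintegral _ _).trans (le_of_eq (hone _ ?_))
          exact lintegral_sub_left_eq_self (fun y => ‖ψ y‖ₑ) x
        calc ‖convOn ψ D w x‖ₑ ^ 2 ≤ (∫⁻ y in D, ‖ψ (x - y)‖ₑ * ‖w y‖ₑ) ^ 2 := by
              gcongr
              refine (enorm_integral_le_lintegral_enorm _).trans (le_of_eq ?_)
              simp_rw [enorm_mul]
          _ ≤ ν Set.univ * ∫⁻ y in D, ‖ψ (x - y)‖ₑ * ‖w y‖ₑ ^ 2 := h1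
          _ ≤ 1 * ∫⁻ y in D, ‖ψ (x - y)‖ₑ * ‖w y‖ₑ ^ 2 := by gcongr
          _ = _ := one_mul _
    _ = ∫⁻ y in D, ∫⁻ x, ‖ψ (x - y)‖ₑ * ‖w y‖ₑ ^ 2 := by
        refine lintegral_lintegral_swap ?_
        have h1 : Measurable fun p : Plane × Plane => ‖ψ (p.1 - p.2)‖ₑ := by fun_prop
        refine h1.aemeasurable.mul ?_
        exact (hw'.pow_const 2).comp_snd
    _ = ∫⁻ y in D, ‖w y‖ₑ ^ 2 := by
        refine lintegral_congr fun y => ?_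
        rw [lintegral_mul_const _ (by fun_prop),
          hone _ (lintegral_sub_right_eq_self (fun y => ‖ψ y‖ₑ) y), one_mul]

/-- The mollifications converge at interior points of continuity. -/
theorem tendsto_convOn_of_continuousOn (hD : IsOpen D) (hf : ContinuousOn f D)
    {φ : ℕ → ContDiffBump (0 : Plane)}
    (hφ : Filter.Tendsto (fun n => (φ n).rOut) Filter.atTop (nhds 0)) {x : Plane} (hx : x ∈ D) :
    Filter.Tendsto (fun n => convOn ((φ n).normed volume) D f x) Filter.atTop (nhds (f x)) := by
  simp_rw [convOn_eq_convolution _ hD.measurableSet]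
  refine ContDiffBump.convolution_tendsto_right (g := fun _ => D.indicator f) (k := fun _ => x)
    (x₀ := x) hφ (Filter.Eventually.of_forall fun _ => ?_) ?_ tendsto_const_nhds
  · exact (aestronglyMeasurable_indicator_iff hD.measurableSet).2
      (hf.aestronglyMeasurable hD.measurableSet)
  · have h1 : Filter.Tendsto (D.indicator f) (nhds x) (nhds (f x)) := by
      refine (hf.continuousAt (hD.mem_nhds hx)).tendsto.congr' ?_
      filter_upwards [hD.mem_nhds hx] with y hy
      rw [Set.indicator_of_mem hy]
    exact h1.comp Filter.tendsto_snd

theorem ae_tendsto_convOn (hD : MeasurableSet D) (hf : IntegrableOn f D)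
    {φ : ℕ → ContDiffBump (0 : Plane)}
    (hφ : Filter.Tendsto (fun n => (φ n).rOut) Filter.atTop (nhds 0))
    (hφ' : ∀ n, (φ n).rOut ≤ 2 * (φ n).rIn) :
    ∀ᵐ x, x ∈ D → Filter.Tendsto (fun n => convOn ((φ n).normed volume) D f x) Filter.atTop
      (nhds (f x)) := by
  filter_upwards [ContDiffBump.ae_convolution_tendsto_right_of_locallyIntegrable hφ
    (Filter.Eventually.of_forall hφ') (locallyIntegrable_indicator hD hf)] with x hx hxD
  simp_rw [convOn_eq_convolution _ hD]
  rwa [Set.indicator_of_mem hxD] at hx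

end

/-! ### Derivatives of polynomials -/

theorem contDiff_eval_mvPolynomial (p : MvPolynomial (Fin 2) ℝ) :
    ContDiff ℝ ∞ fun x : Plane => MvPolynomial.eval (fun k => x k) p := by
  induction p using MvPolynomial.induction_on with
  | C a => simpa using contDiff_const
  | add p q hp hq => simpa using hp.add hq
  | mul_X p i hp =>
    simp only [map_mul, MvPolynomial.eval_X]
    exact hp.mul (by fun_prop)

theorem partialDeriv_eval_mvPolynomial (p : MvPolynomial (Fin 2) ℝ) (j : Fin 2) (x : Plane) :
    partialDeriv j (fun x : Plane => MvPolynomial.eval (fun k => x k) p) x =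
      MvPolynomial.eval (fun k => x k) (MvPolynomial.pderiv j p) := by
  induction p using MvPolynomial.induction_on with
  | C a => simp [partialDeriv]
  | add p q hp hq =>
    have := congrFun (partialDeriv_add (contDiff_eval_mvPolynomial p)
      (contDiff_eval_mvPolynomial q) j) x
    simp only [map_add]
    rw [← hp, ← hq]
    exact this
  | mul_X p i hp =>
    have h1 := ((contDiff_eval_mvPolynomial p).differentiable (by simp) x).hasFDerivAt
    have h2 : HasFDerivAt (fun x : Plane => x i)
        (EuclideanSpace.proj i : Plane →L[ℝ] ℝ) x :=
      (EuclideanSpace.proj i : Plane →L[ℝ] ℝ).hasFDerivAt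
    have h3 := (h1.mul h2).fderiv
    simp only [map_mul, MvPolynomial.eval_X, MvPolynomial.pderiv_mul, map_add]
    rw [← hp]
    unfold partialDeriv
    erw [h3]
    by_cases hij : j = i
    · subst hij
      simp
      ring
    · simp [MvPolynomial.pderiv_X, Ne.symm hij]
      ring

/-- Restriction of a bivariate polynomial to a line gives a polynomial of at most the same degree,
so that directional derivatives are controlled by the values on a segment. -/
theorem exists_abs_directional_pderiv_le (m : ℕ) :
    ∃ C : ℝ, 0 ≤ C ∧ ∀ p : MvPolynomial (Fin 2) ℝ, p.totalDegree ≤ m → ∀ (x v : Plane) (B : ℝ),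
      (∀ s ∈ Set.Icc (0 : ℝ) 1, |MvPolynomial.eval (fun k => (x + s • v) k) p| ≤ B) →
      |v 0 * MvPolynomial.eval (fun k => x k) (MvPolynomial.pderiv 0 p) +
        v 1 * MvPolynomial.eval (fun k => x k) (MvPolynomial.pderiv 1 p)| ≤ C * B := by
  obtain ⟨C, hC, h⟩ := exists_abs_derivative_zero_le m
  refine ⟨C, hC, fun p hp x v B hB => ?_⟩
  let f : Polynomial ℝ := MvPolynomial.aeval
    (fun k : Fin 2 => Polynomial.C (x k) + Polynomial.C (v k) * Polynomial.X) p
  have hdeg : f.natDegree ≤ m := by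
    have := MvPolynomial.aeval_natDegree_le p hp
      (fun k : Fin 2 => Polynomial.C (x k) + Polynomial.C (v k) * Polynomial.X) (n := 1)
      (fun k => by compute_degree)
    rwa [mul_one] at this
  have heval : ∀ s, f.eval s = MvPolynomial.eval (fun k => (x + s • v) k) p := by
    intro s
    have h1 : f.eval s = ((Polynomial.aeval s : Polynomial ℝ →ₐ[ℝ] ℝ).comp (MvPolynomial.aeval
        (fun k : Fin 2 => Polynomial.C (x k) + Polynomial.C (v k) * Polynomial.X))) p := by
      simp [f]
    rw [h1, MvPolynomial.comp_aeval, MvPolynomial.aeval_eq_eval]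
    simp only [map_add, map_mul, Polynomial.aeval_X, Polynomial.aeval_C, PiLp.add_apply,
      PiLp.smul_apply, smul_eq_mul, Algebra.algebraMap_self, RingHom.id_apply]
    congr 2
    funext k
    ring
  have h1 := h f hdeg B fun s hs => by rw [heval]; exact hB s hs
  have h2 := hasDerivAt_along_line (contDiff_eval_mvPolynomial p) x v 0
  simp only [zero_smul, add_zero, partialDeriv_eval_mvPolynomial] at h2
  have h3 : HasDerivAt (fun s => f.eval s) (f.derivative.eval 0) 0 := f.hasDerivAt 0
  simp_rw [heval] at h3
  rwa [← h3.unique h2]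

/-- Markov's inequality on a convex set that contains a disc of radius `ρ`: the derivative at any
point in the direction `e` is the difference of the derivatives in the two directions towards
`c ± ρ e`, divided by `2 ρ`. -/
theorem exists_abs_pderiv_le (m : ℕ) :
    ∃ C : ℝ, 0 ≤ C ∧ ∀ p : MvPolynomial (Fin 2) ℝ, p.totalDegree ≤ m → ∀ (T : Set Plane),
      Convex ℝ T → ∀ (c : Plane) (ρ : ℝ), 0 < ρ → Metric.closedBall c ρ ⊆ T → ∀ B : ℝ,
      (∀ x ∈ T, |MvPolynomial.eval (fun k => x k) p| ≤ B) → ∀ x ∈ T, ∀ j,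
      |MvPolynomial.eval (fun k => x k) (MvPolynomial.pderiv j p)| ≤ C * B / ρ := by
  obtain ⟨C, hC, h⟩ := exists_abs_directional_pderiv_le m
  refine ⟨C, hC, fun p hp T hT c ρ hρ hcT B hB x hx j => ?_⟩
  have hmem : ∀ a : ℝ, |a| = ρ → c + a • EuclideanSpace.single j (1 : ℝ) ∈ T := by
    intro a ha
    refine hcT ?_
    rw [Metric.mem_closedBall, dist_eq_norm, add_sub_cancel_left, norm_smul]
    simp [ha]
  have hdir : ∀ a : ℝ, |a| = ρ → _ := fun a ha =>
    h p hp x (c + a • EuclideanSpace.single j (1 : ℝ) - x) B fun s hs => by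
      refine hB _ ?_
      have := hT hx (hmem a ha) (sub_nonneg.2 hs.2) hs.1 (by ring)
      convert this using 1
      module
  have h1 := hdir ρ (abs_of_pos hρ)
  have h2 := hdir (-ρ) (by rw [abs_neg, abs_of_pos hρ])
  rw [le_div_iff₀ hρ]
  rw [abs_le] at h1 h2
  have habs : ∀ t : ℝ, |t| * ρ = |t * ρ| := fun t => by rw [abs_mul, abs_of_pos hρ]
  rw [habs, abs_le]
  fin_cases j <;> simp at h1 h2 ⊢ <;> constructor <;> linarith [h1.1, h1.2, h2.1, h2.2]

/-! ### Triangles -/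

section Triangle

variable {T : Finset Plane}

theorem IsTriangle.affineSpan_eq_top (hT : IsTriangle T) :
    affineSpan ℝ (T : Set Plane) = ⊤ := by
  have h := (hT.2.affineSpan_eq_top_iff_card_eq_finrank_add_one).2
    (by rw [Fintype.card_coe, hT.1, finrank_euclideanSpace, Fintype.card_fin])
  simpa using h

theorem isCompact_triangle (T : Finset Plane) : IsCompact (triangle T) :=
  T.finite_toSet.isCompact_convexHull ℝ

/-- The radii of the inscribed discs are bounded and not all nonpositive, so their supremum is a
genuine one, and a disc of more than half that radius is inscribed. -/
theorem IsTriangle.exists_closedBall_subset (hT : IsTriangle T) :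
    0 < inscribedRadius (triangle T) ∧
      ∃ (c : Plane) (ρ : ℝ), 0 < ρ ∧ inscribedRadius (triangle T) < 2 * ρ ∧
        Metric.closedBall c ρ ⊆ triangle T := by
  have hb : BddAbove {r : ℝ | ∃ c : Plane, Metric.closedBall c r ⊆ triangle T} := by
    refine ⟨Metric.diam (triangle T), ?_⟩
    rintro r ⟨c, hc⟩
    rcases le_total r 0 with hr | hr
    · exact hr.trans Metric.diam_nonneg
    have h1 : c + r • EuclideanSpace.single 0 (1 : ℝ) ∈ triangle T := hc (by
      rw [Metric.mem_closedBall, dist_eq_norm, add_sub_cancel_left, norm_smul]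
      simp [abs_of_nonneg hr])
    have h2 := Metric.dist_le_diam_of_mem (isCompact_triangle T).isBounded h1
      (hc (Metric.mem_closedBall_self hr))
    rw [dist_eq_norm, add_sub_cancel_left, norm_smul] at h2
    simpa [abs_of_nonneg hr] using h2
  have hne : (interior (triangle T)).Nonempty := by
    rw [triangle, interior_convexHull_nonempty_iff_affineSpan_eq_top]
    exact hT.affineSpan_eq_top
  obtain ⟨c, hc⟩ := hne
  obtain ⟨ε, hε, hcε⟩ := Metric.isOpen_iff.1 isOpen_interior c hc
  have hmem : ε / 2 ∈ {r : ℝ | ∃ c : Plane, Metric.closedBall c r ⊆ triangle T} :=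
    ⟨c, (Metric.closedBall_subset_ball (by linarith)).trans (hcε.trans interior_subset)⟩
  have hpos : 0 < inscribedRadius (triangle T) := (by linarith : 0 < ε / 2).trans_le
    (le_csSup hb hmem)
  obtain ⟨ρ, ⟨c', hc'⟩, hρ⟩ := exists_lt_of_lt_csSup ⟨_, hmem⟩ (half_lt_self hpos)
  have hρ' : inscribedRadius (triangle T) / 2 < ρ := hρ
  exact ⟨hpos, c', ρ, by linarith, by linarith, hc'⟩

/-- A point of a triangle that is not interior has a vanishing barycentric coordinate. -/
theorem IsTriangle.diff_interior_subset (hT : IsTriangle T) :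
    triangle T \ interior (triangle T) ⊆
      ⋃ a ∈ T, convexHull ℝ ((T.erase a : Finset Plane) : Set Plane) := by
  classical
  let b : AffineBasis T ℝ Plane := ⟨(↑), hT.2, by simpa using hT.affineSpan_eq_top⟩
  have hr : Set.range b = (T : Set Plane) := by
    change Set.range ((↑) : T → Plane) = _
    simp
  rintro x ⟨hx, hxi⟩
  rw [triangle, ← hr, b.interior_convexHull] at hxi
  rw [triangle, ← hr, b.convexHull_eq_nonneg_coord] at hx
  simp only [Set.mem_ofPred_eq, not_forall, not_lt] at hxi hx
  obtain ⟨a, ha⟩ := hxi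
  have ha0 : b.coord a x = 0 := le_antisymm ha (hx a)
  refine Set.mem_biUnion a.2 ?_
  rw [← b.linear_combination_coord_eq_self x, ← Finset.add_sum_erase _ _ (Finset.mem_univ a), ha0,
    zero_smul, zero_add]
  refine (convex_convexHull ℝ _).sum_mem (fun j _ => hx j) ?_ fun j hj => ?_
  · have := b.sum_coord_apply_eq_one x
    rwa [← Finset.add_sum_erase _ _ (Finset.mem_univ a), ha0, zero_add] at this
  · refine subset_convexHull ℝ _ ?_
    have : j ≠ a := Finset.ne_of_mem_erase hj
    change (j : Plane) ∈ ((T.erase a : Finset Plane) : Set Plane)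
    simpa using fun h => this (Subtype.ext h)

theorem IsTriangle.hausdorffMeasure_edge_le (hT : IsTriangle T) {a : Plane} (ha : a ∈ T) :
    Measure.hausdorffMeasure 1 (convexHull ℝ ((T.erase a : Finset Plane) : Set Plane)) ≤
      ENNReal.ofReal (Metric.diam (triangle T)) := by
  have hcard : (T.erase a).card = 2 := by rw [Finset.card_erase_of_mem ha, hT.1]
  obtain ⟨p, q, -, hpq⟩ := Finset.card_eq_two.1 hcard
  have hp : p ∈ T := Finset.mem_of_mem_erase (a := a) (by rw [hpq]; simp)
  have hq : q ∈ T := Finset.mem_of_mem_erase (a := a) (by rw [hpq]; simp)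
  rw [hpq, Finset.coe_pair, convexHull_pair, hausdorffMeasure_segment, edist_dist]
  exact ENNReal.ofReal_le_ofReal (Metric.dist_le_diam_of_mem (isCompact_triangle T).isBounded
    (subset_convexHull ℝ _ hp) (subset_convexHull ℝ _ hq))

theorem volume_le_diam_sq {A : Set Plane} (hA : Bornology.IsBounded A) :
    volume A ≤ ENNReal.ofReal (Metric.diam A ^ 2 * discArea) := by
  rcases A.eq_empty_or_nonempty with rfl | ⟨a, ha⟩
  · simp
  rw [← volume_closedBall_plane a _ Metric.diam_nonneg]
  exact measure_mono fun x hx => Metric.dist_le_diam_of_mem hA hx ha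

end Triangle

/-! ### Elements and patches of a polygonal mesh -/

theorem IsPolygonalDomain.isOpen {U : Set Plane} (hU : IsPolygonalDomain U) : IsOpen U := by
  obtain ⟨-, 𝒯, -, rfl⟩ := hU
  exact isOpen_interior

theorem isCompact_iUnion_triangle (𝒯 : Finset (Finset Plane)) :
    IsCompact (⋃ T ∈ 𝒯, triangle T) :=
  𝒯.finite_toSet.isCompact_biUnion fun T _ => isCompact_triangle T

theorem IsPolygonalDomain.isBounded {U : Set Plane} (hU : IsPolygonalDomain U) :
    Bornology.IsBounded U := by
  obtain ⟨-, 𝒯, -, rfl⟩ := hU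
  exact (isCompact_iUnion_triangle 𝒯).isBounded.subset interior_subset

/-- A polygonal domain has no slits or punctures. -/
theorem IsPolygonalDomain.interior_closure {U : Set Plane} (hU : IsPolygonalDomain U) :
    interior (closure U) = U := by
  refine Set.Subset.antisymm ?_ (interior_maximal subset_closure hU.isOpen)
  obtain ⟨-, 𝒯, -, rfl⟩ := hU
  exact interior_mono (closure_minimal interior_subset (isCompact_iUnion_triangle 𝒯).isClosed)

section Patch

variable {ι : Type} [Fintype ι] {M : PolygonalMesh ι}

theorem PatchData.elem_subset_region (P : PatchData M) {K K' : ι} (h : K' ∈ P.patch K) :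
    M.elem K' ⊆ P.region K := by
  refine interior_maximal ?_ (M.elem_polygonal K').isOpen
  exact subset_closure.trans (Set.subset_biUnion_of_mem (u := fun K' => closure (M.elem K')) h)

theorem PatchData.isBounded_region (P : PatchData M) (K : ι) :
    Bornology.IsBounded (P.region K) := by
  refine Bornology.IsBounded.subset ?_ interior_subset
  exact (Bornology.isBounded_biUnion_finset _).2 fun K' _ =>
    (M.elem_polygonal K').isBounded.closure

theorem PatchData.isOpen_region (P : PatchData M) (K : ι) : IsOpen (P.region K) :=
  isOpen_interior

theorem PatchData.node_mem_region (P : PatchData M) {K K' : ι} (h : K' ∈ P.patch K) :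
    P.node K' ∈ P.region K :=
  P.elem_subset_region h (P.node_mem K')

end Patch

/-- The boundary of an element that consists of at most `N` triangles is contained in their
edges. -/
theorem hausdorffMeasure_frontier_le {U : Set Plane} (hU : IsPolygonalDomain U)
    {𝒯 : Finset (Finset Plane)} {N : ℕ} (hN : 𝒯.card ≤ N)
    (hcl : closure U = ⋃ T ∈ 𝒯, triangle T) (h𝒯 : ∀ T ∈ 𝒯, IsTriangle T) :
    Measure.hausdorffMeasure 1 (frontier U) ≤ ENNReal.ofReal (3 * N * Metric.diam U) := by
  have hdiam : ∀ T ∈ 𝒯, Metric.diam (triangle T) ≤ Metric.diam U := by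
    intro T hT
    rw [← Metric.diam_closure U]
    refine Metric.diam_mono ?_ hU.isBounded.closure
    rw [hcl]
    exact Set.subset_biUnion_of_mem (u := triangle) hT
  have hsub : frontier U ⊆
      ⋃ T ∈ 𝒯, ⋃ a ∈ T, convexHull ℝ ((T.erase a : Finset Plane) : Set Plane) := by
    intro x hx
    have hxc : x ∈ ⋃ T ∈ 𝒯, triangle T := hcl ▸ hx.1
    obtain ⟨T, hT, hxT⟩ := Set.mem_iUnion₂.1 hxc
    refine Set.mem_biUnion hT ((h𝒯 T hT).diff_interior_subset ⟨hxT, fun hxi => hx.2 ?_⟩)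
    rw [hU.isOpen.interior_eq, ← hU.interior_closure, hcl]
    exact interior_mono (Set.subset_biUnion_of_mem (u := triangle) hT) hxi
  calc Measure.hausdorffMeasure 1 (frontier U)
      ≤ ∑ T ∈ 𝒯, ∑ a ∈ T, Measure.hausdorffMeasure 1
          (convexHull ℝ ((T.erase a : Finset Plane) : Set Plane)) :=
        (measure_mono hsub).trans ((measure_biUnion_finset_le _ _).trans
          (Finset.sum_le_sum fun T _ => measure_biUnion_finset_le _ _))
    _ ≤ ∑ T ∈ 𝒯, ∑ a ∈ T, ENNReal.ofReal (Metric.diam U) :=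
        Finset.sum_le_sum fun T hT => Finset.sum_le_sum fun a ha =>
          ((h𝒯 T hT).hausdorffMeasure_edge_le ha).trans (ENNReal.ofReal_le_ofReal (hdiam T hT))
    _ = ∑ T ∈ 𝒯, ENNReal.ofReal (3 * Metric.diam U) := by
        refine Finset.sum_congr rfl fun T hT => ?_
        rw [Finset.sum_const, (h𝒯 T hT).1, nsmul_eq_mul, ENNReal.ofReal_mul (by norm_num)]
        norm_num
    _ ≤ ENNReal.ofReal (3 * N * Metric.diam U) := by
        rw [Finset.sum_const, nsmul_eq_mul, ← ENNReal.ofReal_natCast,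
          ← ENNReal.ofReal_mul (by positivity)]
        refine ENNReal.ofReal_le_ofReal ?_
        have h1 : (𝒯.card : ℝ) ≤ N := by exact_mod_cast hN
        have h2 : 0 ≤ 3 * Metric.diam U := by have := Metric.diam_nonneg (s := U); positivity
        nlinarith

/-- The inverse inequality on a shape regular element: the factor `ρ⁻¹` of Markov's inequality is
compensated by the diameter of the triangle. -/
theorem exists_eLpNorm_pderiv_le (m N : ℕ) (σ : ℝ) :
    ∃ C : ℝ, 0 ≤ C ∧ ∀ (U : Set Plane) (𝒯 : Finset (Finset Plane)), 𝒯.card ≤ N →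
      closure U = ⋃ T ∈ 𝒯, triangle T →
      (∀ T ∈ 𝒯, IsTriangle T ∧ Metric.diam (triangle T) / inscribedRadius (triangle T) ≤ σ) →
      ∀ (p : MvPolynomial (Fin 2) ℝ), p.totalDegree ≤ m → ∀ B : ℝ, 0 ≤ B →
      (∀ x ∈ closure U, |MvPolynomial.eval (fun k => x k) p| ≤ B) → ∀ j,
      eLpNorm (fun x : Plane => MvPolynomial.eval (fun k => x k) (MvPolynomial.pderiv j p)) 2
        (volume.restrict U) ≤ ENNReal.ofReal (C * B) := by
  obtain ⟨C, hC, hCp⟩ := exists_abs_pderiv_le m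
  refine ⟨Real.sqrt (N * discArea) * (C * (2 * |σ|)), by positivity,
    fun U 𝒯 hN hcl h𝒯 p hp B hB0 hB j => ?_⟩
  have hda := discArea_pos
  rw [← ENNReal.pow_le_pow_left_iff two_ne_zero, eLpNorm_two_sq]
  have hT : ∀ T ∈ 𝒯, ∫⁻ x in triangle T,
      ‖MvPolynomial.eval (fun k => x k) (MvPolynomial.pderiv j p)‖ₑ ^ 2 ≤
      ENNReal.ofReal (discArea * (C * (2 * |σ|) * B) ^ 2) := by
    intro T hT
    obtain ⟨h2, c, ρ, hρ, hρ2, hc⟩ := (h𝒯 T hT).1.exists_closedBall_subset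
    have hsub : triangle T ⊆ closure U := by
      rw [hcl]; exact Set.subset_biUnion_of_mem (u := triangle) hT
    have hb := hCp p hp (triangle T) (convex_convexHull ℝ _) c ρ hρ hc B
      fun x hx => hB x (hsub hx)
    set h := Metric.diam (triangle T) with hh
    have hh0 : 0 ≤ h := Metric.diam_nonneg
    have hhρ : h ≤ 2 * |σ| * ρ := by
      have h1 : h / inscribedRadius (triangle T) ≤ |σ| := (h𝒯 T hT).2.trans (le_abs_self σ)
      rw [div_le_iff₀ h2] at h1
      nlinarith [abs_nonneg σ]
    calc ∫⁻ x in triangle T, ‖MvPolynomial.eval (fun k => x k) (MvPolynomial.pderiv j p)‖ₑ ^ 2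
        ≤ ∫⁻ x in triangle T, ENNReal.ofReal (C * B / ρ) ^ 2 := by
          refine setLIntegral_mono measurable_const fun x hx => ?_
          gcongr
          rw [← ofReal_norm, Real.norm_eq_abs]
          exact ENNReal.ofReal_le_ofReal (hb x hx j)
      _ = ENNReal.ofReal (C * B / ρ) ^ 2 * volume (triangle T) := setLIntegral_const _ _
      _ ≤ ENNReal.ofReal (C * B / ρ) ^ 2 * ENNReal.ofReal (h ^ 2 * discArea) := by
          gcongr
          exact volume_le_diam_sq (isCompact_triangle T).isBounded
      _ ≤ _ := by
          rw [← ENNReal.ofReal_pow (by positivity), ← ENNReal.ofReal_mul (by positivity)]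
          refine ENNReal.ofReal_le_ofReal ?_
          calc (C * B / ρ) ^ 2 * (h ^ 2 * discArea)
              ≤ (C * B / ρ) ^ 2 * ((2 * |σ| * ρ) ^ 2 * discArea) := by gcongr
            _ = _ := by field_simp
  calc ∫⁻ x in U, ‖MvPolynomial.eval (fun k => x k) (MvPolynomial.pderiv j p)‖ₑ ^ 2
      ≤ ∫⁻ x in ⋃ T ∈ 𝒯, triangle T,
          ‖MvPolynomial.eval (fun k => x k) (MvPolynomial.pderiv j p)‖ₑ ^ 2 := by
        refine lintegral_mono_set ?_
        rw [← hcl]; exact subset_closure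
    _ ≤ ∑ T ∈ 𝒯, ∫⁻ x in triangle T,
          ‖MvPolynomial.eval (fun k => x k) (MvPolynomial.pderiv j p)‖ₑ ^ 2 := by
        rw [← Finset.sum_coe_sort 𝒯, ← tsum_fintype (L := .unconditional 𝒯)]
        have h1 : (⋃ T ∈ 𝒯, triangle T) = ⋃ T : 𝒯, triangle T := by ext x; simp
        rw [h1]
        exact lintegral_iUnion_le _ _
    _ ≤ ∑ T ∈ 𝒯, ENNReal.ofReal (discArea * (C * (2 * |σ|) * B) ^ 2) := Finset.sum_le_sum hT
    _ ≤ _ := by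
        rw [Finset.sum_const, nsmul_eq_mul, ← ENNReal.ofReal_natCast,
          ← ENNReal.ofReal_mul (by positivity), ← ENNReal.ofReal_pow (by positivity)]
        refine ENNReal.ofReal_le_ofReal ?_
        have h1 : (𝒯.card : ℝ) ≤ N := by exact_mod_cast hN
        rw [mul_assoc (Real.sqrt _), mul_pow (Real.sqrt _), Real.sq_sqrt (by positivity)]
        calc (𝒯.card : ℝ) * (discArea * (C * (2 * |σ|) * B) ^ 2)
            ≤ N * (discArea * (C * (2 * |σ|) * B) ^ 2) := by gcongr
          _ = _ := by ring

/-! ### The discrete least-squares problem and the Lebesgue constant -/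

theorem exists_norm_sub_le_of_finiteDimensional {V E : Type*} [AddCommGroup V] [Module ℝ V]
    [NormedAddCommGroup E] [InnerProductSpace ℝ E] (L : V →ₗ[ℝ] E) (W : Submodule ℝ V)
    [FiniteDimensional ℝ W] (u : E) : ∃ p ∈ W, ∀ q ∈ W, ‖u - L p‖ ≤ ‖u - L q‖ := by
  obtain ⟨v, hvR, hv⟩ := (W.map L).exists_norm_eq_iInf_of_complete_subspace
    (Submodule.complete_of_finiteDimensional (W.map L)) u
  obtain ⟨p, hp, rfl⟩ := Submodule.mem_map.1 hvR
  refine ⟨p, hp, fun q hq => ?_⟩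
  rw [hv]
  have hbdd : BddBelow (Set.range fun w : W.map L => ‖u - w‖) :=
    ⟨0, by rintro _ ⟨w, rfl⟩; exact norm_nonneg _⟩
  exact ciInf_le hbdd (⟨L q, Submodule.mem_map_of_mem hq⟩ : W.map L)

section LeastSquares

variable {ι : Type} [Fintype ι] {M : PolygonalMesh ι} (P : PatchData M)

theorem PatchData.Unisolvent.eq_zero {P : PatchData M} {m : ℕ} (h : P.Unisolvent m) {K : ι}
    {p : PolyField} (hp : p ∈ solenoidalPoly m)
    (h0 : ∀ K' ∈ P.patch K, p.toFun (P.node K') = 0) : p = 0 :=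
  PolyField.eq_zero_of_isOpen (P.isOpen_region K)
    ⟨_, P.node_mem_region (P.self_mem K)⟩ (h K p hp h0)

/-- The values of a vector field at the sampling nodes of `S(K)`, with the Euclidean norm. -/
noncomputable def PatchData.sample (K : ι) (g : Plane → Plane) :
    PiLp 2 (fun _ : P.patch K => Plane) :=
  WithLp.toLp 2 fun K' => g (P.node K')

theorem PatchData.norm_sample_sq (K : ι) (g : Plane → Plane) :
    ‖P.sample K g‖ ^ 2 = ∑ K' ∈ P.patch K, ‖g (P.node K')‖ ^ 2 := by
  rw [PiLp.norm_sq_eq_of_L2]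
  exact Finset.sum_coe_sort (P.patch K) fun K' => ‖g (P.node K')‖ ^ 2

/-- Sampling of polynomial fields as a linear map. -/
noncomputable def PatchData.samplePoly (K : ι) :
    PolyField →ₗ[ℝ] PiLp 2 (fun _ : P.patch K => Plane) where
  toFun p := P.sample K p.toFun
  map_add' p q := by
    ext K' i
    simp [PatchData.sample, PolyField.toFun]
  map_smul' a p := by
    ext K' i
    simp [PatchData.sample, PolyField.toFun]

theorem PatchData.isLeastSquares_iff {m : ℕ} {K : ι} {g : Plane → Plane} {p : PolyField} :
    P.IsLeastSquares m K g p ↔ p ∈ solenoidalPoly m ∧ ∀ q ∈ solenoidalPoly m,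
      ‖P.sample K g - P.samplePoly K p‖ ≤ ‖P.sample K g - P.samplePoly K q‖ := by
  have h : ∀ q : PolyField, ∑ K' ∈ P.patch K, ‖g (P.node K') - q.toFun (P.node K')‖ ^ 2 =
      ‖P.sample K g - P.samplePoly K q‖ ^ 2 := fun q =>
    (P.norm_sample_sq K fun x => g x - q.toFun x).symm
  simp only [PatchData.IsLeastSquares, h]
  refine and_congr_right fun _ => forall₂_congr fun q _ => ?_
  exact pow_le_pow_iff_left₀ (norm_nonneg _) (norm_nonneg _) two_ne_zero

theorem PatchData.exists_isLeastSquares (m : ℕ) (K : ι) (g : Plane → Plane) :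
    ∃ p, P.IsLeastSquares m K g p := by
  obtain ⟨p, hp, hmin⟩ := exists_norm_sub_le_of_finiteDimensional (P.samplePoly K)
    (solenoidalSubmodule m) (P.sample K g)
  exact ⟨p, (P.isLeastSquares_iff).2 ⟨hp, hmin⟩⟩

/-- Two solutions have the same values at the nodes by the parallelogram law. -/
theorem PatchData.existsUnique_isLeastSquares {m : ℕ} (h : P.Unisolvent m) (K : ι)
    (g : Plane → Plane) : ∃! p, P.IsLeastSquares m K g p := by
  obtain ⟨p, hp⟩ := P.exists_isLeastSquares m K g
  refine ⟨p, hp, fun p' hp' => ?_⟩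
  rw [P.isLeastSquares_iff] at hp hp'
  have hmid := hp.2 _ ((solenoidalSubmodule m).smul_mem (1 / 2 : ℝ)
    ((solenoidalSubmodule m).add_mem hp.1 hp'.1))
  have h1 := hp'.2 p hp.1
  have h2 := hp.2 p' hp'.1
  rw [map_smul, map_add] at hmid
  set a := P.sample K g - P.samplePoly K p with ha
  set b := P.sample K g - P.samplePoly K p' with hb
  have hpar := parallelogram_law_with_norm ℝ a b
  have hsum : a + b = (2 : ℝ) • (P.sample K g -
      (1 / 2 : ℝ) • (P.samplePoly K p + P.samplePoly K p')) := by
    rw [ha, hb]; module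
  have h3 : 2 * ‖a‖ ≤ ‖a + b‖ := by
    rw [hsum, norm_smul, Real.norm_of_nonneg (by norm_num)]
    linarith
  have h4 : ‖a - b‖ = 0 := by
    have := norm_nonneg a
    have := norm_nonneg (a - b)
    nlinarith
  have h5 : P.samplePoly K (p' - p) = 0 := by
    rw [map_sub]
    have : a - b = P.samplePoly K p' - P.samplePoly K p := by rw [ha, hb]; abel
    rw [← this]
    exact norm_eq_zero.1 h4
  have h6 : p' - p = 0 := by
    refine h.eq_zero (K := K) ((solenoidalSubmodule m).sub_mem hp'.1 hp.1) fun K' hK' => ?_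
    exact congrFun (congrArg WithLp.ofLp h5) ⟨K', hK'⟩
  exact sub_eq_zero.1 h6

/-- Stability: the least-squares solution deviates from any other candidate `q` at the nodes at
most in proportion to the error of `q` at the nodes. -/
theorem PatchData.IsLeastSquares.norm_sub_le {P : PatchData M} {m : ℕ} {K : ι}
    {g : Plane → Plane} {p q : PolyField} (hp : P.IsLeastSquares m K g p)
    (hq : q ∈ solenoidalPoly m) {A : ℝ}
    (hA : ∀ K' ∈ P.patch K, ‖g (P.node K') - q.toFun (P.node K')‖ ≤ A) :
    ∀ K' ∈ P.patch K, ‖(q - p).toFun (P.node K')‖ ≤ 2 * Real.sqrt (P.patch K).card * A := by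
  intro K' hK'
  have hA0 : 0 ≤ A := (norm_nonneg _).trans (hA K' hK')
  have h1 := ((P.isLeastSquares_iff).1 hp).2 q hq
  have h2 : ‖P.sample K g - P.samplePoly K q‖ ≤ Real.sqrt (P.patch K).card * A := by
    rw [← pow_le_pow_iff_left₀ (norm_nonneg _) (by positivity) two_ne_zero, mul_pow,
      Real.sq_sqrt (by positivity)]
    have h3 := P.norm_sample_sq K fun x => g x - q.toFun x
    calc ‖P.sample K g - P.samplePoly K q‖ ^ 2
        = ∑ K' ∈ P.patch K, ‖g (P.node K') - q.toFun (P.node K')‖ ^ 2 := h3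
      _ ≤ ∑ K' ∈ P.patch K, A ^ 2 := Finset.sum_le_sum fun K' hK' => by
          gcongr
          exact hA K' hK'
      _ = _ := by rw [Finset.sum_const, nsmul_eq_mul]
  calc ‖(q - p).toFun (P.node K')‖ = ‖(P.samplePoly K (q - p)) ⟨K', hK'⟩‖ := rfl
    _ ≤ ‖P.samplePoly K (q - p)‖ := PiLp.norm_apply_le _ _
    _ = ‖(P.sample K g - P.samplePoly K p) - (P.sample K g - P.samplePoly K q)‖ := by
        rw [map_sub, sub_sub_sub_cancel_left]
    _ ≤ ‖P.sample K g - P.samplePoly K p‖ + ‖P.sample K g - P.samplePoly K q‖ :=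
        _root_.norm_sub_le _ _
    _ ≤ _ := by linarith

/-- For a continuous field on an open set the essential supremum is an upper bound everywhere. -/
theorem enorm_le_eLpNorm_top {U : Set Plane} (hU : IsOpen U) {f : Plane → Plane}
    (hf : Continuous f) {x : Plane} (hx : x ∈ U) :
    ‖f x‖ₑ ≤ eLpNorm f ⊤ (volume.restrict U) := by
  by_contra! hlt
  have hopen : IsOpen (U ∩ {y | eLpNorm f ⊤ (volume.restrict U) < ‖f y‖ₑ}) :=
    hU.inter (isOpen_lt continuous_const hf.enorm)
  have hpos : 0 < volume (U ∩ {y | eLpNorm f ⊤ (volume.restrict U) < ‖f y‖ₑ}) :=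
    hopen.measure_pos volume ⟨x, hx, hlt⟩
  have hae : ∀ᵐ y ∂volume.restrict U, ‖f y‖ₑ ≤ eLpNorm f ⊤ (volume.restrict U) := by
    rw [eLpNorm_exponent_top]
    exact ae_le_eLpNormEssSup
  rw [ae_restrict_iff' hU.measurableSet] at hae
  refine hpos.ne' (measure_mono_null (fun y hy => ?_) hae)
  simpa using ⟨hy.1, hy.2⟩

/-- The defining property of `Λ(m, I(K))`. -/
theorem PatchData.enorm_toFun_le_lebesgueConst {m : ℕ} (h : P.Unisolvent m) {K : ι}
    {p : PolyField} (hp : p ∈ solenoidalPoly m) {A : ℝ}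
    (hA : ∀ K' ∈ P.patch K, ‖p.toFun (P.node K')‖ ≤ A) {x : Plane} (hx : x ∈ P.region K) :
    ‖p.toFun x‖ₑ ≤ P.lebesgueConst m K * ENNReal.ofReal A := by
  have hle : ⨆ K' ∈ P.patch K, ‖p.toFun (P.node K')‖ₑ ≤ ENNReal.ofReal A :=
    iSup₂_le fun K' hK' => by
      rw [← ofReal_norm]
      exact ENNReal.ofReal_le_ofReal (hA K' hK')
  refine le_trans ?_ (mul_le_mul_right hle _)
  -- If `p` vanishes at all nodes, the quotient that defines `Λ` is uninformative, and unisolvence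
  -- has to be used instead.
  rcases eq_or_ne (⨆ K' ∈ P.patch K, ‖p.toFun (P.node K')‖ₑ) 0 with h0 | h0
  · have hp0 : p.toFun x = 0 := by
      refine h K p hp (fun K' hK' => ?_) x hx
      have := (le_iSup₂ (f := fun K' (_ : K' ∈ P.patch K) => ‖p.toFun (P.node K')‖ₑ) K' hK').trans
        h0.le
      simpa using this
    simp [hp0]
  · refine (enorm_le_eLpNorm_top (P.isOpen_region K) p.continuous_toFun hx).trans ?_
    rw [← ENNReal.div_le_iff h0 (hle.trans_lt ENNReal.ofReal_lt_top).ne]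
    exact le_iSup₂ (f := fun (p : PolyField) (_ : p ∈ solenoidalPoly m) =>
      eLpNorm p.toFun ⊤ (volume.restrict (P.region K)) /
        ⨆ K' ∈ P.patch K, ‖p.toFun (P.node K')‖ₑ) p hp

/-- All norms on the finite-dimensional space `𝕊_m` are equivalent, and the values at the nodes
define one of them. -/
theorem PatchData.lebesgueConst_lt_top {m : ℕ} (h : P.Unisolvent m) (K : ι) :
    P.lebesgueConst m K < ⊤ := by
  obtain ⟨C, hC, hCp⟩ := exists_norm_toFun_le m (X := {x | ∃ K' ∈ P.patch K, x = P.node K'})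
    (P.isBounded_region K) fun p hp hX => h.eq_zero hp fun K' hK' => hX _ ⟨K', hK', rfl⟩
  refine lt_of_le_of_lt (iSup₂_le fun p hp => ?_) (ENNReal.ofReal_lt_top (r := C))
  refine ENNReal.div_le_of_le_mul ?_
  set S := ⨆ K' ∈ P.patch K, ‖p.toFun (P.node K')‖ₑ with hS
  have hle : ∀ K' ∈ P.patch K, ‖p.toFun (P.node K')‖ₑ ≤ S := fun K' hK' =>
    le_iSup₂ (f := fun K' (_ : K' ∈ P.patch K) => ‖p.toFun (P.node K')‖ₑ) K' hK'
  have hfin : S < ⊤ := by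
    rw [hS, ← Finset.sup_eq_iSup]
    exact (Finset.sup_lt_iff ENNReal.zero_lt_top).2 fun K' _ => enorm_lt_top
  have hnode : ∀ x ∈ {x | ∃ K' ∈ P.patch K, x = P.node K'}, ‖p.toFun x‖ ≤ S.toReal := by
    rintro _ ⟨K', hK', rfl⟩
    rw [← toReal_enorm]
    exact ENNReal.toReal_mono hfin.ne (hle K' hK')
  rw [eLpNorm_exponent_top]
  refine essSup_le_of_ae_le _ ?_
  filter_upwards [ae_restrict_mem (P.isOpen_region K).measurableSet] with x hx
  rw [← ofReal_norm]
  refine (ENNReal.ofReal_le_ofReal (hCp p hp _ hnode x hx)).trans ?_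
  rw [ENNReal.ofReal_mul hC, ENNReal.ofReal_toReal hfin.ne]

end LeastSquares

/-! ### Approximation of solenoidal Sobolev fields -/

theorem integrable_mul_of_tsupport_subset {D : Set Plane} {v ψ : Plane → ℝ}
    (hv : LocallyIntegrableOn v D) (hψ : Continuous ψ) (hc : HasCompactSupport ψ)
    (hs : tsupport ψ ⊆ D) : Integrable fun x => v x * ψ x := by
  have h1 : IntegrableOn v (tsupport ψ) := hv.integrableOn_compact_subset hs hc
  have h2 : IntegrableOn (fun x => v x * ψ x) (tsupport ψ) :=
    h1.mul_continuousOn hψ.continuousOn hc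
  refine (integrableOn_iff_integrable_of_support_subset fun x hx => ?_).1 h2
  exact subset_tsupport ψ (Function.mem_support.2 fun h => hx (by simp [h]))

/-- Weak derivatives are unique almost everywhere, so the infimum in `weakDerivNorm` is attained by
every weak derivative. -/
theorem IsWeakDeriv.eLpNorm_le_weakDerivNorm {D : Set Plane} (hD : IsOpen D) {α : ℕ × ℕ}
    {u w : Plane → ℝ} (hw : IsWeakDeriv D α u w) :
    eLpNorm w 2 (volume.restrict D) ≤ weakDerivNorm D α u := by
  refine le_iInf₂ fun w' hw' => le_of_eq ?_
  refine eLpNorm_congr_ae ?_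
  have hloc : LocallyIntegrableOn (fun x => w x - w' x) D := hw.2.1.sub hw'.2.1
  have h0 := hD.ae_eq_zero_of_integral_contDiff_smul_eq_zero hloc fun φ hφ hc hs => by
    have hint : ∀ {v : Plane → ℝ}, LocallyIntegrableOn v D →
        Integrable (fun x => v x * φ x) (volume.restrict D) :=
      fun hv => (integrable_mul_of_tsupport_subset hv hφ.continuous hc hs).mono_measure
        Measure.restrict_le_self
    have e1 := hw.2.2 φ ⟨hφ, hc, hs⟩
    have e2 := hw'.2.2 φ ⟨hφ, hc, hs⟩
    have e3 : ∫ x in D, w x * φ x = ∫ x in D, w' x * φ x :=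
      mul_left_cancel₀ (pow_ne_zero _ (by norm_num)) (e1.symm.trans e2)
    have e4 : ∫ x in D, φ x • (w x - w' x) = 0 := by
      have : ∀ x, φ x • (w x - w' x) = w x * φ x - w' x * φ x := fun x => by
        rw [smul_eq_mul]; ring
      simp_rw [this]
      rw [integral_sub (hint hw.2.1) (hint hw'.2.1), e3, sub_self]
    rw [← e4]
    refine (setIntegral_eq_integral_of_forall_compl_eq_zero fun x hx => ?_).symm
    rw [image_eq_zero_of_notMem_tsupport fun h => hx (hs h), zero_smul]
  rw [Filter.EventuallyEq, ae_restrict_iff' hD.measurableSet]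
  filter_upwards [h0] with x hx hxD
  exact sub_eq_zero.1 (hx hxD)

theorem weakDerivNorm_le_sobolevSeminorm {k : ℕ} (D : Set Plane) (v : Plane → Plane) (i : Fin 2)
    {α : ℕ × ℕ} (hα : α ∈ Finset.HasAntidiagonal.antidiagonal k) :
    weakDerivNorm D α (fun x => v x i) ≤ sobolevSeminorm k D v := by
  rw [sobolevSeminorm]
  have h1 : weakDerivNorm D α (fun x => v x i) ^ 2 ≤ ∑ i : Fin 2,
      ∑ α ∈ Finset.HasAntidiagonal.antidiagonal k, weakDerivNorm D α (fun x => v x i) ^ 2 :=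
    (Finset.single_le_sum (f := fun α => weakDerivNorm D α (fun x => v x i) ^ 2)
      (fun _ _ => zero_le) hα).trans (Finset.single_le_sum (f := fun i =>
      ∑ α ∈ Finset.HasAntidiagonal.antidiagonal k, weakDerivNorm D α (fun x => v x i) ^ 2)
      (fun _ _ => zero_le) (Finset.mem_univ i))
  calc weakDerivNorm D α (fun x => v x i)
      = (weakDerivNorm D α (fun x => v x i) ^ 2) ^ (1 / 2 : ℝ) := by
        rw [← ENNReal.rpow_natCast, ← ENNReal.rpow_mul]; norm_num
    _ ≤ _ := by gcongr

/-- The erosion `{x | B(x, ε) ⊆ D}` of a set by an open ball. -/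
def erosion (D : Set Plane) (ε : ℝ) : Set Plane := {x | Metric.ball x ε ⊆ D}

theorem isClosed_erosion (D : Set Plane) (ε : ℝ) : IsClosed (erosion D ε) := by
  have h : erosion D ε = (Metric.thickening ε Dᶜ)ᶜ := by
    ext x
    simp only [erosion, Set.mem_ofPred_eq, Set.mem_compl_iff, Metric.mem_thickening_iff, not_exists,
      not_and, not_lt]
    refine ⟨fun h z hz => ?_, fun h z hz => ?_⟩
    · by_contra! hlt
      exact hz (h (by rwa [Metric.mem_ball, dist_comm]))
    · by_contra hzD
      exact (h z hzD).not_gt (by rwa [dist_comm])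
  rw [h]
  exact Metric.isOpen_thickening.isClosed_compl

theorem erosion_subset (D : Set Plane) {ε : ℝ} (hε : 0 < ε) : erosion D ε ⊆ D :=
  fun _ hx => hx (Metric.mem_ball_self hε)

/-- Erosion by `ε` preserves star-shapedness with respect to a ball, whose radius decreases
by `ε`. -/
theorem segment_mem_erosion {D : Set Plane} {c : Plane} {r r' ε : ℝ} (hr : r' + ε ≤ r)
    (hstar : ∀ y ∈ Metric.ball c r, StarConvex ℝ y D) {x y : Plane} (hx : x ∈ erosion D ε)
    (hy : y ∈ Metric.ball c r') {s : ℝ} (hs : s ∈ Set.Ioo (0 : ℝ) 1) :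
    (1 - s) • y + s • x ∈ erosion D ε := by
  intro z hz
  set e := z - ((1 - s) • y + s • x) with he
  have hen : ‖e‖ < ε := by rwa [Metric.mem_ball, dist_eq_norm] at hz
  have h1 : y + e ∈ Metric.ball c r := by
    rw [Metric.mem_ball, dist_eq_norm] at hy ⊢
    calc ‖y + e - c‖ = ‖(y - c) + e‖ := by congr 1; abel
      _ ≤ ‖y - c‖ + ‖e‖ := norm_add_le _ _
      _ < r := by linarith
  have h2 : x + e ∈ D := hx (by rwa [Metric.mem_ball, dist_eq_norm, add_sub_cancel_left])
  have h3 := hstar _ h1 h2 (sub_nonneg.2 hs.2.le) hs.1.le (by ring)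
  convert h3 using 1
  rw [he]
  module

/-- The multi-index of the first partial derivative in the direction `j`. -/
def unitIndex (j : Fin 2) : ℕ × ℕ := if j = 0 then (1, 0) else (0, 1)

theorem multiPartialDeriv_unitIndex (j : Fin 2) (u : Plane → ℝ) :
    multiPartialDeriv (unitIndex j) u = partialDeriv j u := by
  fin_cases j <;> rfl

/-- Mollifications of a solenoidal Sobolev field, on sets that exhaust the domain, are
approximated by solenoidal polynomial fields with a bound that does not depend on the mollification
parameter. -/
theorem exists_mollified_approx (m : ℕ) (hm : 1 ≤ m) (γ : ℝ) :
    ∃ C : ℝ≥0, ∀ (D : Set Plane) (g : Plane → Plane), IsOpen D → Bornology.IsBounded D →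
      StarShapedWithChunkiness D γ → ContinuousOn g (closure D) →
      MemSolenoidalSobolev (m + 1) D g →
      ∃ (φ : ℕ → ContDiffBump (0 : Plane)) (q : ℕ → PolyField) (E : ℕ → Set Plane),
        Filter.Tendsto (fun n => (φ n).rOut) Filter.atTop (nhds 0) ∧
        (∀ n, (φ n).rOut ≤ 2 * (φ n).rIn) ∧ (∀ n, q n ∈ solenoidalPoly m) ∧
        (∀ n, MeasurableSet (E n)) ∧
        (∀ x ∈ D, ∀ᶠ n in Filter.atTop, x ∈ E n) ∧
        (∀ n, ∀ x ∈ E n, ∀ i,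
          ‖convOn ((φ n).normed volume) D (fun y => g y i) x - (q n).toFun x i‖ₑ ≤
            C * ENNReal.ofReal (Metric.diam D ^ m) * sobolevSeminorm (m + 1) D g) ∧
        (∀ n i j w, IsWeakDeriv D (unitIndex j) (fun y => g y i) w →
          eLpNorm (fun x => convOn ((φ n).normed volume) D w x -
            MvPolynomial.eval (fun k => x k) (MvPolynomial.pderiv j (q n i))) 2
            (volume.restrict (E n)) ≤
            C * ENNReal.ofReal (Metric.diam D ^ m) * sobolevSeminorm (m + 1) D g) := by
  obtain ⟨C, hC⟩ := exists_solenoidal_approx m hm (2 * γ)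
  -- There are `m + 2` multi-indices of order `m + 1`.
  refine ⟨C * (m + 2 : ℕ), fun D g hD hb hstar hg hsob => ?_⟩
  obtain ⟨c, r, hr, hcr, hstar, hdr⟩ := hstar
  -- For `ε n ≤ r / 2` the erosions are star-shaped with respect to the ball of radius `r / 2`,
  -- which doubles the chunkiness parameter. The mollifiers are supported in closed discs of radius
  -- `ε n / 2`, whose translates to points of the erosion stay in `D`.
  let ε : ℕ → ℝ := fun n => r / 2 / (n + 1)
  have hε : ∀ n, 0 < ε n := fun n => by positivity
  have hεr : ∀ n, ε n ≤ r / 2 := fun n => div_le_self (by positivity) (by simp)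
  have hε0 : Filter.Tendsto ε Filter.atTop (nhds 0) := by
    have := tendsto_one_div_add_atTop_nhds_zero_nat (𝕜 := ℝ) |>.const_mul (r / 2)
    simpa [ε, div_eq_mul_inv] using this
  let φ : ℕ → ContDiffBump (0 : Plane) := fun n =>
    ⟨ε n / 4, ε n / 2, by linarith [hε n], by linarith [hε n]⟩
  have hgi : ∀ i, IntegrableOn (fun y => g y i) D := fun i => by
    have hgi : ContinuousOn (fun y => g y i) (closure D) := by fun_prop
    exact (hgi.integrableOn_compact hb.isCompact_closure).mono_set subset_closure
  have hφs : ∀ n, ContDiff ℝ ∞ ((φ n).normed (volume : Measure Plane)) := fun n =>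
    (φ n).contDiff_normed
  have hφc : ∀ n, HasCompactSupport ((φ n).normed (volume : Measure Plane)) := fun n =>
    (φ n).hasCompactSupport_normed
  have hφt : ∀ n, tsupport ((φ n).normed (volume : Measure Plane)) ⊆
      Metric.closedBall 0 (ε n / 2) := fun n => ((φ n).tsupport_normed_eq).le
  have hcb : ∀ n, ∀ x ∈ erosion D (ε n), Metric.closedBall x (ε n / 2) ⊆ D := fun n x hx =>
    (Metric.closedBall_subset_ball (by linarith [hε n])).trans hx
  let u : ℕ → Fin 2 → Plane → ℝ := fun n i =>
    convOn ((φ n).normed volume) D (fun y => g y i)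
  have hu : ∀ n i, ContDiff ℝ ∞ (u n i) := fun n i =>
    contDiff_convOn (hφs n) (hφc n) hD.measurableSet (hgi i)
  have hball : ∀ n, Metric.ball c (r / 2) ⊆ erosion D (ε n) := by
    intro n y hy z hz
    refine hcr ?_
    rw [Metric.mem_ball] at *
    linarith [dist_triangle z y c, hεr n]
  have happ := fun n => hC (u n) (hu n) c (r / 2) (Metric.diam D) (erosion D (ε n)) (by positivity)
    (by linarith) (isClosed_erosion D (ε n)).measurableSet
    (hball n (Metric.mem_ball_self (by positivity)))
    (fun x hx y hy s hs => segment_mem_erosion (by linarith [hεr n]) hstar hx hy hs)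
    (fun x hx y hy => by
      rw [← dist_eq_norm]
      exact Metric.dist_le_diam_of_mem hb (erosion_subset D (hε n) hx)
        (erosion_subset D (hε n) (hball n hy)))
    (fun y hy => sum_partialDeriv_convOn_eq_zero (hφs n) (hφc n) (hφt n) hD.measurableSet hgi
      hsob.2 (hcb n y (hball n hy)))
  choose q hq hq1 hq2 using happ
  have hsum : ∀ n i, ∑ α ∈ Finset.HasAntidiagonal.antidiagonal (m + 1),
      eLpNorm (multiPartialDeriv α (u n i)) 2 (volume.restrict (erosion D (ε n))) ≤
      (m + 2 : ℕ) * sobolevSeminorm (m + 1) D g := by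
    intro n i
    calc _ ≤ ∑ α ∈ Finset.HasAntidiagonal.antidiagonal (m + 1),
          sobolevSeminorm (m + 1) D g := by
          refine Finset.sum_le_sum fun α hα => ?_
          have hαm : α.1 + α.2 = m + 1 := Finset.HasAntidiagonal.mem_antidiagonal.1 hα
          obtain ⟨w, hw, hwL⟩ := hsob.1 i α hαm.le
          calc eLpNorm (multiPartialDeriv α (u n i)) 2 (volume.restrict (erosion D (ε n)))
              = eLpNorm (convOn ((φ n).normed volume) D w) 2
                  (volume.restrict (erosion D (ε n))) := by
                refine eLpNorm_congr_ae ?_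
                filter_upwards [ae_restrict_mem (isClosed_erosion D (ε n)).measurableSet] with x hx
                exact multiPartialDeriv_convOn_eq (hφs n) (hφc n) (hφt n) hD.measurableSet (hgi i)
                  hw (hcb n x hx)
            _ ≤ eLpNorm (convOn ((φ n).normed volume) D w) 2 volume :=
                eLpNorm_mono_measure _ Measure.restrict_le_self
            _ ≤ eLpNorm w 2 (volume.restrict D) := eLpNorm_convOn_le (φ n) hwL.1
            _ ≤ weakDerivNorm D α (fun y => g y i) := hw.eLpNorm_le_weakDerivNorm hD
            _ ≤ _ := weakDerivNorm_le_sobolevSeminorm D g i hα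
      _ = _ := by rw [Finset.sum_const, Finset.Nat.card_antidiagonal, nsmul_eq_mul]
  have hbound : ∀ n i, C * ENNReal.ofReal (Metric.diam D ^ m) *
      ∑ α ∈ Finset.HasAntidiagonal.antidiagonal (m + 1),
        eLpNorm (multiPartialDeriv α (u n i)) 2 (volume.restrict (erosion D (ε n))) ≤
      ((C * (m + 2 : ℕ) : ℝ≥0) : ℝ≥0∞) * ENNReal.ofReal (Metric.diam D ^ m) *
        sobolevSeminorm (m + 1) D g := by
    intro n i
    refine (mul_le_mul_right (hsum n i) _).trans (le_of_eq ?_)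
    push_cast
    ring
  refine ⟨φ, q, fun n => erosion D (ε n), ?_, fun n => ?_, hq,
    fun n => (isClosed_erosion D (ε n)).measurableSet, ?_, ?_, ?_⟩
  · simpa using hε0.div_const 2
  · change ε n / 2 ≤ 2 * (ε n / 4)
    linarith
  · intro x hx
    obtain ⟨δ, hδ, hxδ⟩ := Metric.isOpen_iff.1 hD x hx
    filter_upwards [hε0.eventually (gt_mem_nhds hδ)] with n hn
    exact (Metric.ball_subset_ball hn.le).trans hxδ
  · exact fun n x hx i => (hq1 n x hx i).trans (hbound n i)
  · intro n i j w hw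
    refine le_trans (le_of_eq ?_) ((hq2 n j i).trans (hbound n i))
    refine eLpNorm_congr_ae ?_
    filter_upwards [ae_restrict_mem (isClosed_erosion D (ε n)).measurableSet] with x hx
    have := multiPartialDeriv_convOn_eq (hφs n) (hφc n) (hφt n) hD.measurableSet (hgi i) hw
      (hcb n x hx)
    rw [multiPartialDeriv_unitIndex] at this
    rw [← this]

/-! ### Passage to the limit in the mollification parameter -/

theorem sobolevSeminorm_lt_top {k : ℕ} {D : Set Plane} {g : Plane → Plane}
    (hg : MemSobolev k D g) : sobolevSeminorm k D g < ⊤ := by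
  rw [sobolevSeminorm]
  refine ENNReal.rpow_lt_top_of_nonneg (by norm_num) (ne_of_lt ?_)
  refine ENNReal.sum_lt_top.2 fun i _ => ENNReal.sum_lt_top.2 fun α hα => ?_
  obtain ⟨w, hw, hwL⟩ := hg i α (Finset.HasAntidiagonal.mem_antidiagonal.1 hα).le
  exact ENNReal.pow_lt_top ((iInf₂_le w hw).trans_lt hwL.2)

theorem norm_plane_le (v : Plane) : ‖v‖ ≤ ∑ i, |v i| := by
  conv_lhs => rw [plane_eq_sum v]
  rw [Fin.sum_univ_two]
  refine (norm_add_le _ _).trans ?_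
  simp [norm_smul]

/-- Subtracting a polynomial from a function subtracts the classical derivative of the polynomial
from the weak derivative; weak derivatives restrict to open subsets. -/
theorem IsWeakDeriv.sub_eval {D U : Set Plane} (hU : IsOpen U) (hUD : U ⊆ D) {j : Fin 2}
    {f w : Plane → ℝ} (hw : IsWeakDeriv D (unitIndex j) f w) (p : MvPolynomial (Fin 2) ℝ) :
    IsWeakDeriv U (unitIndex j) (fun x => f x - MvPolynomial.eval (fun k => x k) p)
      (fun x => w x - MvPolynomial.eval (fun k => x k) (MvPolynomial.pderiv j p)) := by
  have hpl : ∀ p : MvPolynomial (Fin 2) ℝ, LocallyIntegrableOn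
      (fun x : Plane => MvPolynomial.eval (fun k => x k) p) U := fun p =>
    (continuous_eval_mvPolynomial p).continuousOn.locallyIntegrableOn hU.measurableSet
  have hfU : LocallyIntegrableOn f U := hw.1.mono_set hUD
  have hwU : LocallyIntegrableOn w U := hw.2.1.mono_set hUD
  refine ⟨hfU.sub (hpl p), hwU.sub (hpl _), fun φ hφ => ?_⟩
  obtain ⟨hφs, hφc, hφt⟩ := hφ
  rw [multiPartialDeriv_unitIndex]
  have hdc : HasCompactSupport (partialDeriv j φ) := hφc.partialDeriv j
  have hdt : tsupport (partialDeriv j φ) ⊆ U :=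
    (tsupport_fderiv_apply_subset ℝ _).trans hφt
  have hds := (hφs.partialDeriv j).continuous
  have hsign : (-1 : ℝ) ^ ((unitIndex j).1 + (unitIndex j).2) = -1 := by
    fin_cases j <;> simp [unitIndex]
  have hset : ∀ (A : Set Plane) (v ψ : Plane → ℝ), tsupport ψ ⊆ A →
      ∫ x in A, v x * ψ x = ∫ x, v x * ψ x := fun A v ψ hA =>
    setIntegral_eq_integral_of_forall_compl_eq_zero fun x hx => by
      rw [image_eq_zero_of_notMem_tsupport fun h => hx (hA h), mul_zero]
  have h1 := hw.2.2 φ ⟨hφs, hφc, hφt.trans hUD⟩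
  rw [multiPartialDeriv_unitIndex, hset D f _ (hdt.trans hUD), hset D w _ (hφt.trans hUD),
    hsign] at h1
  have h2 : ∫ x : Plane, MvPolynomial.eval (fun k => x k) p * partialDeriv j φ x =
      -∫ x : Plane, MvPolynomial.eval (fun k => x k) (MvPolynomial.pderiv j p) * φ x := by
    have hp := contDiff_eval_mvPolynomial p
    have h3 := integral_mul_fderiv_eq_neg_fderiv_mul_of_integrable (𝕜 := ℝ)
      (μ := (volume : Measure Plane)) (v := EuclideanSpace.single j (1 : ℝ))
      (f := fun x : Plane => MvPolynomial.eval (fun k => x k) p) (g := φ) ?_ ?_ ?_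
      (fun x _ => hp.differentiable (by simp) x) (fun x _ => hφs.differentiable (by simp) x)
    · simp_rw [← partialDeriv_eval_mvPolynomial]
      exact h3
    · exact integrable_mul_of_tsupport_subset
        ((hp.partialDeriv j).continuous.continuousOn.locallyIntegrableOn hU.measurableSet)
        hφs.continuous hφc hφt
    · exact integrable_mul_of_tsupport_subset (hpl p) hds hdc hdt
    · exact integrable_mul_of_tsupport_subset (hpl p) hφs.continuous hφc hφt
  rw [hset U _ _ hdt, hset U _ _ hφt, hsign]
  simp_rw [sub_mul]
  rw [integral_sub (integrable_mul_of_tsupport_subset hfU hds hdc hdt)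
      (integrable_mul_of_tsupport_subset (hpl p) hds hdc hdt),
    integral_sub (integrable_mul_of_tsupport_subset hwU hφs.continuous hφc hφt)
      (integrable_mul_of_tsupport_subset (hpl _) hφs.continuous hφc hφt), h1, h2]
  ring

section Reconstruction

variable {ι : Type} [Fintype ι] {M : PolygonalMesh ι} {P : PatchData M} {m : ℕ} {K : ι}
  {g : Plane → Plane} {p : PolyField} {u : ℕ → Fin 2 → Plane → ℝ} {q : ℕ → PolyField}
  {E : ℕ → Set Plane} {X : ℝ}

theorem norm_sub_toFun_le {n : ℕ} {x : Plane} (hX : ∀ i, |u n i x - (q n).toFun x i| ≤ X) :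
    ‖g x - (q n).toFun x‖ ≤ ∑ i, |g x i - u n i x| + 2 * X := by
  refine (norm_plane_le _).trans ?_
  have h : ∀ i, |(g x - (q n).toFun x) i| ≤ |g x i - u n i x| + X := fun i => by
    rw [PiLp.sub_apply]
    exact (abs_sub_le _ (u n i x) _).trans (by linarith [hX i])
  rw [Fin.sum_univ_two, Fin.sum_univ_two]
  linarith [h 0, h 1]

/-- If `q n` approximates `u n` up to `X` and `u n` converges to `g`, then the least-squares
solution deviates from `q n` in the limit at most by `4 Λ √#I(K) X`. -/
theorem PatchData.IsLeastSquares.exists_tendsto_bound (huni : P.Unisolvent m)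
    (hp : P.IsLeastSquares m K g p) (hq : ∀ n, q n ∈ solenoidalPoly m)
    (hE : ∀ x ∈ P.region K, ∀ᶠ n in Filter.atTop, x ∈ E n)
    (hu : ∀ x ∈ P.region K, ∀ i,
      Filter.Tendsto (fun n => u n i x) Filter.atTop (nhds (g x i)))
    (hX : ∀ n, ∀ x ∈ E n, ∀ i, |u n i x - (q n).toFun x i| ≤ X) :
    ∃ Y : ℕ → ℝ≥0∞, (∀ n, Y n < ⊤) ∧ Filter.Tendsto Y Filter.atTop (nhds
      (P.lebesgueConst m K * ENNReal.ofReal (4 * Real.sqrt (P.patch K).card * X))) ∧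
      ∀ᶠ n in Filter.atTop, ∀ x ∈ P.region K, ‖(q n - p).toFun x‖ₑ ≤ Y n := by
  let δ : ℕ → Plane → ℝ := fun n x => ∑ i, |g x i - u n i x|
  have hδ0 : ∀ n x, 0 ≤ δ n x := fun n x => Finset.sum_nonneg fun _ _ => abs_nonneg _
  have hδ : ∀ x ∈ P.region K, Filter.Tendsto (fun n => δ n x) Filter.atTop (nhds 0) := by
    intro x hx
    have := tendsto_finsetSum (Finset.univ : Finset (Fin 2)) fun i _ =>
      ((hu x hx i).const_sub (g x i)).abs
    simpa [δ] using this
  -- `A n` bounds the error of `q n` at all nodes; the factor 2 in `2 * X` counts the components.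
  let A : ℕ → ℝ := fun n => ∑ K' ∈ P.patch K, δ n (P.node K') + 2 * X
  have hA : Filter.Tendsto A Filter.atTop (nhds (2 * X)) := by
    have := (tendsto_finsetSum (P.patch K) fun K' hK' => hδ _ (P.node_mem_region hK')).add_const
      (2 * X)
    simpa using this
  have hΛ := P.lebesgueConst_lt_top huni K
  refine ⟨fun n => P.lebesgueConst m K *
    ENNReal.ofReal (2 * Real.sqrt (P.patch K).card * A n), fun n =>
    ENNReal.mul_lt_top hΛ ENNReal.ofReal_lt_top, ?_, ?_⟩
  · refine ENNReal.Tendsto.const_mul ?_ (Or.inr hΛ.ne)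
    refine ENNReal.tendsto_ofReal ?_
    have := hA.const_mul (2 * Real.sqrt (P.patch K).card)
    convert this using 2
    ring
  · have hnodes : ∀ᶠ n in Filter.atTop, ∀ K' ∈ P.patch K, P.node K' ∈ E n :=
      (Finset.eventually_all (P.patch K)).2 fun K' hK' => hE _ (P.node_mem_region hK')
    filter_upwards [hnodes] with n hn x hx
    refine P.enorm_toFun_le_lebesgueConst huni ((solenoidalSubmodule m).sub_mem (hq n) hp.1)
      (hp.norm_sub_le (hq n) fun K' hK' => ?_) hx
    refine (norm_sub_toFun_le (hX n _ (hn K' hK'))).trans ?_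
    have := Finset.single_le_sum (f := fun K' => δ n (P.node K')) (fun _ _ => hδ0 _ _) hK'
    simp only [A]
    linarith

/-- The uniform error bound on the closed patch. -/
theorem PatchData.IsLeastSquares.enorm_sub_le (huni : P.Unisolvent m)
    (hp : P.IsLeastSquares m K g p) (hg : ContinuousOn g (closure (P.region K)))
    (hq : ∀ n, q n ∈ solenoidalPoly m)
    (hE : ∀ x ∈ P.region K, ∀ᶠ n in Filter.atTop, x ∈ E n)
    (hu : ∀ x ∈ P.region K, ∀ i,
      Filter.Tendsto (fun n => u n i x) Filter.atTop (nhds (g x i)))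
    (hX : ∀ n, ∀ x ∈ E n, ∀ i, |u n i x - (q n).toFun x i| ≤ X) :
    ∀ x ∈ closure (P.region K), ‖g x - p.toFun x‖ₑ ≤ ENNReal.ofReal (2 * X) +
      P.lebesgueConst m K * ENNReal.ofReal (4 * Real.sqrt (P.patch K).card * X) := by
  obtain ⟨Y, -, hY, hqp⟩ := hp.exists_tendsto_bound huni hq hE hu hX
  have hin : ∀ x ∈ P.region K, ‖g x - p.toFun x‖ₑ ≤ ENNReal.ofReal (2 * X) +
      P.lebesgueConst m K * ENNReal.ofReal (4 * Real.sqrt (P.patch K).card * X) := by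
    intro x hx
    have hδ : Filter.Tendsto (fun n => ∑ i, |g x i - u n i x| + 2 * X) Filter.atTop
        (nhds (2 * X)) := by
      have := (tendsto_finsetSum (Finset.univ : Finset (Fin 2)) fun i _ =>
        ((hu x hx i).const_sub (g x i)).abs).add_const (2 * X)
      simpa using this
    refine ge_of_tendsto ((ENNReal.tendsto_ofReal hδ).add hY) ?_
    filter_upwards [hE x hx, hqp] with n hn hqn
    calc ‖g x - p.toFun x‖ₑ = ‖(g x - (q n).toFun x) + (q n - p).toFun x‖ₑ := by
          rw [PolyField.toFun_sub, sub_add_sub_cancel]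
      _ ≤ ‖g x - (q n).toFun x‖ₑ + ‖(q n - p).toFun x‖ₑ := enorm_add_le _ _
      _ ≤ _ := by
          refine add_le_add ?_ (hqn x hx)
          rw [← ofReal_norm]
          exact ENNReal.ofReal_le_ofReal (norm_sub_toFun_le (hX n x hn))
  intro x hx
  have : (nhdsWithin x (P.region K)).NeBot := mem_closure_iff_nhdsWithin_neBot.1 hx
  have ht : Filter.Tendsto (fun x => ‖g x - p.toFun x‖ₑ) (nhdsWithin x (P.region K))
      (nhds ‖g x - p.toFun x‖ₑ) :=
    (((hg x hx).mono subset_closure).sub p.continuous_toFun.continuousWithinAt).enorm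
  refine le_of_tendsto ht ?_
  filter_upwards [self_mem_nhdsWithin] with y hy using hin y hy

/-- The error bound for the derivatives: the bounds for the mollified field pass to the limit by
Fatou's lemma, and the inverse inequality controls the derivatives of `q n - p`. -/
theorem PatchData.IsLeastSquares.eLpNorm_sub_pderiv_le (huni : P.Unisolvent m)
    (hp : P.IsLeastSquares m K g p) (hq : ∀ n, q n ∈ solenoidalPoly m)
    (hE : ∀ x ∈ P.region K, ∀ᶠ n in Filter.atTop, x ∈ E n) (hEm : ∀ n, MeasurableSet (E n))
    (hu : ∀ x ∈ P.region K, ∀ i,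
      Filter.Tendsto (fun n => u n i x) Filter.atTop (nhds (g x i)))
    (hX : ∀ n, ∀ x ∈ E n, ∀ i, |u n i x - (q n).toFun x i| ≤ X) {C : ℝ} (hC : 0 ≤ C) {i j : Fin 2}
    (hinv : ∀ f : MvPolynomial (Fin 2) ℝ, f.totalDegree ≤ m → ∀ B : ℝ, 0 ≤ B →
      (∀ x ∈ closure (M.elem K), |MvPolynomial.eval (fun k => x k) f| ≤ B) →
      eLpNorm (fun x : Plane => MvPolynomial.eval (fun k => x k) (MvPolynomial.pderiv j f)) 2
        (volume.restrict (M.elem K)) ≤ ENNReal.ofReal (C * B))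
    {w : Plane → ℝ} {v : ℕ → Plane → ℝ} (hv : ∀ n, Continuous (v n))
    (hvw : ∀ᵐ x, x ∈ P.region K → Filter.Tendsto (fun n => v n x) Filter.atTop (nhds (w x)))
    (hvX : ∀ n, eLpNorm (fun x => v n x -
      MvPolynomial.eval (fun k => x k) (MvPolynomial.pderiv j (q n i))) 2
      (volume.restrict (E n)) ≤ ENNReal.ofReal X) :
    eLpNorm (fun x => w x - MvPolynomial.eval (fun k => x k) (MvPolynomial.pderiv j (p i))) 2
      (volume.restrict (M.elem K)) ≤ ENNReal.ofReal X + ENNReal.ofReal C *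
        (P.lebesgueConst m K * ENNReal.ofReal (4 * Real.sqrt (P.patch K).card * X)) := by
  obtain ⟨Y, hYtop, hY, hqp⟩ := hp.exists_tendsto_bound huni hq hE hu hX
  have hKD : M.elem K ⊆ P.region K := P.elem_subset_region (P.self_mem K)
  let dp : PolyField → Plane → ℝ := fun p x =>
    MvPolynomial.eval (fun k => x k) (MvPolynomial.pderiv j (p i))
  have hdp : ∀ p, Continuous (dp p) := fun p => continuous_eval_mvPolynomial _
  let f : ℕ → Plane → ℝ := fun n => (E n).indicator fun x => v n x - dp p x
  have hlim : ∀ᵐ x ∂volume.restrict (M.elem K),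
      Filter.Tendsto (fun n => f n x) Filter.atTop (nhds (w x - dp p x)) := by
    rw [ae_restrict_iff' (M.elem_polygonal K).isOpen.measurableSet]
    filter_upwards [hvw] with x hx hxK
    refine ((hx (hKD hxK)).sub_const (dp p x)).congr' ?_
    filter_upwards [hE x (hKD hxK)] with n hn
    simp only [f, Set.indicator_of_mem hn]
  have hfm : ∀ n, AEStronglyMeasurable (f n) (volume.restrict (M.elem K)) := fun n =>
    (((hv n).sub (hdp p)).aestronglyMeasurable).indicator (hEm n)
  refine (Lp.eLpNorm_lim_le_liminf_eLpNorm hfm _ hlim).trans ?_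
  have hlim2 : Filter.Tendsto (fun n => ENNReal.ofReal X + ENNReal.ofReal C * Y n) Filter.atTop
      (nhds (ENNReal.ofReal X + ENNReal.ofReal C *
        (P.lebesgueConst m K * ENNReal.ofReal (4 * Real.sqrt (P.patch K).card * X)))) :=
    (ENNReal.Tendsto.const_mul hY (Or.inr ENNReal.ofReal_ne_top)).const_add _
  rw [← hlim2.liminf_eq]
  refine Filter.liminf_le_liminf ?_
  filter_upwards [hqp] with n hn
  have hsplit : f n = (E n).indicator (fun x => v n x - dp (q n) x) +
      (E n).indicator (dp (q n - p)) := by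
    funext x
    by_cases hx : x ∈ E n
    · simp only [f, dp, Pi.add_apply, Set.indicator_of_mem hx, Pi.sub_apply, map_sub]
      ring
    · simp only [f, Pi.add_apply, Set.indicator_of_notMem hx, add_zero]
  rw [hsplit]
  refine (eLpNorm_add_le (((hv n).sub (hdp _)).aestronglyMeasurable.indicator (hEm n))
    ((hdp _).aestronglyMeasurable.indicator (hEm n)) (by norm_num)).trans (add_le_add ?_ ?_)
  · rw [eLpNorm_indicator_eq_eLpNorm_restrict (hEm n)]
    exact (eLpNorm_mono_measure _ (Measure.restrict_mono_measure Measure.restrict_le_self _)).trans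
      (hvX n)
  · refine (eLpNorm_indicator_le _).trans ?_
    have hcl : ∀ x ∈ closure (M.elem K), ‖(q n - p).toFun x‖ₑ ≤ Y n := fun x hx =>
      closure_minimal (s := M.elem K) (t := {x | ‖(q n - p).toFun x‖ₑ ≤ Y n})
        (fun x hx => hn x (hKD hx))
        (isClosed_le ((q n - p).continuous_toFun).enorm continuous_const) hx
    refine (hinv ((q n - p) i) (((solenoidalSubmodule m).sub_mem (hq n) hp.1).1 i) (Y n).toReal
      ENNReal.toReal_nonneg fun x hx => ?_).trans (le_of_eq ?_)
    · rw [← PolyField.toFun_apply]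
      refine (PiLp.norm_apply_le ((q n - p).toFun x) i).trans ?_
      rw [← toReal_enorm]
      exact ENNReal.toReal_mono (hYtop n).ne (hcl x hx)
    · rw [ENNReal.ofReal_mul hC, ENNReal.ofReal_toReal (hYtop n).ne]

end Reconstruction

/-! ### The error of the reconstruction on an element -/

theorem eLpNorm_two_le_of_forall_enorm_le {α E : Type*} [MeasurableSpace α] [NormedAddCommGroup E]
    {μ : Measure α} {f : α → E} {S : ℝ≥0∞} {b : ℝ} (hb : 0 ≤ b)
    (h : ∀ᵐ x ∂μ, ‖f x‖ₑ ≤ S) (hμ : μ Set.univ ≤ ENNReal.ofReal b) :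
    eLpNorm f 2 μ ≤ S * ENNReal.ofReal (Real.sqrt b) := by
  refine (eLpNorm_le_of_ae_enorm_bound h).trans ?_
  rw [smul_eq_mul, Real.sqrt_eq_rpow, ← ENNReal.ofReal_rpow_of_nonneg hb (by norm_num)]
  refine mul_le_mul_right ?_ S
  have : ((2 : ℝ≥0∞).toReal)⁻¹ = (1 / 2 : ℝ) := by norm_num
  rw [this]
  exact ENNReal.rpow_le_rpow hμ (by norm_num)

/-- Four partial derivatives bounded by `Z` in the mean square sum up to `(4 Z²)^(1/2) = 2 Z`. -/
theorem sobolevSeminorm_one_le {U : Set Plane} {v : Plane → Plane} {Z : ℝ≥0∞}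
    (h : ∀ i j, weakDerivNorm U (unitIndex j) (fun x => v x i) ≤ Z) :
    sobolevSeminorm 1 U v ≤ 2 * Z := by
  have hα : ∀ i : Fin 2, ∑ α ∈ Finset.HasAntidiagonal.antidiagonal 1,
      weakDerivNorm U α (fun x => v x i) ^ 2 ≤ 2 * Z ^ 2 := by
    intro i
    have h0 := h i 0
    have h1 := h i 1
    simp only [unitIndex] at h0 h1
    rw [Finset.Nat.antidiagonal_succ]
    simp only [Finset.Nat.antidiagonal_zero, Finset.map_singleton, Finset.sum_cons,
      Finset.sum_singleton, two_mul]
    exact add_le_add (pow_le_pow_left' h1 2) (pow_le_pow_left' h0 2)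
  rw [sobolevSeminorm, Fin.sum_univ_two]
  calc _ ≤ (2 * Z ^ 2 + 2 * Z ^ 2) ^ (1 / 2 : ℝ) := by
        gcongr
        · exact hα 0
        · exact hα 1
    _ = ((2 * Z) ^ 2) ^ (1 / 2 : ℝ) := by congr 1; ring
    _ = 2 * Z := by rw [← ENNReal.rpow_natCast, ← ENNReal.rpow_mul]; norm_num

theorem mainTheorem3 (m N : ℕ) (hm : 1 ≤ m) (σ γ : ℝ) :
    ∃ C : ℝ≥0, ∀ (ι : Type) [Fintype ι] (M : PolygonalMesh ι) (P : PatchData M),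
      M.ShapeRegular N σ → P.Unisolvent m →
      ∀ K : ι, StarShapedWithChunkiness (P.region K) γ →
      ∀ g : Plane → Plane, ContinuousOn g (closure (P.region K)) →
        MemSolenoidalSobolev (m + 1) (P.region K) g →
        (∃! p : PolyField, P.IsLeastSquares m K g p) ∧
        ∀ p : PolyField, P.IsLeastSquares m K g p →
          eLpNorm (fun x => g x - p.toFun x) 2 (volume.restrict (M.elem K)) ≤
            C * P.lebesgueMax m *
              ENNReal.ofReal (Metric.diam (M.elem K) * Metric.diam (P.region K) ^ m) *
              sobolevSeminorm (m + 1) (P.region K) g ∧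
          sobolevSeminorm 1 (M.elem K) (fun x => g x - p.toFun x) ≤
            C * (ENNReal.ofReal (Metric.diam (M.elem K) ^ m) +
              P.lebesgueMax m * ENNReal.ofReal (Metric.diam (P.region K) ^ m)) *
              sobolevSeminorm (m + 1) (P.region K) g ∧
          eLpNorm (fun x => g x - p.toFun x) 2
              ((Measure.hausdorffMeasure 1).restrict (frontier (M.elem K))) ≤
            C * P.lebesgueMax m *
              ENNReal.ofReal (Real.sqrt (Metric.diam (M.elem K)) *
                Metric.diam (P.region K) ^ m) *
              sobolevSeminorm (m + 1) (P.region K) g := by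
  obtain ⟨C₁, hC₁⟩ := exists_mollified_approx m hm γ
  obtain ⟨C₂, hC₂0, hC₂⟩ := exists_eLpNorm_pderiv_le m N σ
  set a := Real.toNNReal (Real.sqrt discArea) with ha
  set b := Real.toNNReal (Real.sqrt (3 * N)) with hb
  set e := Real.toNNReal C₂ with he
  -- The summands `a`, `2 (1 + e)` and `b` serve the area, the gradient and the boundary estimate.
  refine ⟨4 * C₁ * (a + 2 * (1 + e) + b), fun ι _ M P hreg huni K hstar g hg hsob =>
    ⟨P.existsUnique_isLeastSquares huni K g, fun p hp => ?_⟩⟩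
  have hDo := P.isOpen_region K
  have hKD : M.elem K ⊆ P.region K := P.elem_subset_region (P.self_mem K)
  have hKp := M.elem_polygonal K
  obtain ⟨𝒯, h𝒯, h𝒯', -⟩ := hreg
  obtain ⟨φ, q, E, hφ, hφ', hq, hEm, hE, hX, hX'⟩ := hC₁ _ g hDo (P.isBounded_region K) hstar
    hg hsob
  set S := sobolevSeminorm (m + 1) (P.region K) g with hS
  set h := Metric.diam (M.elem K) with hh
  set d := Metric.diam (P.region K) with hd
  have hh0 : 0 ≤ h := Metric.diam_nonneg
  have hd0 : 0 ≤ d := Metric.diam_nonneg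
  -- `X` is the bound for the polynomial approximation, as a real number.
  set X := (C₁ * ENNReal.ofReal (d ^ m) * S).toReal with hXdef
  have hStop : S < ⊤ := sobolevSeminorm_lt_top hsob.1
  have hXe : ENNReal.ofReal X = C₁ * ENNReal.ofReal (d ^ m) * S :=
    ENNReal.ofReal_toReal
      (ENNReal.mul_lt_top (ENNReal.mul_lt_top ENNReal.coe_lt_top ENNReal.ofReal_lt_top) hStop).ne
  have hX0 : 0 ≤ X := ENNReal.toReal_nonneg
  have hgi : ∀ i, ContinuousOn (fun y => g y i) (P.region K) := fun i => by
    have := hg.mono subset_closure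
    fun_prop
  have hu : ∀ x ∈ P.region K, ∀ i, Filter.Tendsto
      (fun n => convOn ((φ n).normed volume) (P.region K) (fun y => g y i) x) Filter.atTop
      (nhds (g x i)) := fun x hx i => tendsto_convOn_of_continuousOn hDo (hgi i) hφ hx
  have hXr : ∀ n, ∀ x ∈ E n, ∀ i, |convOn ((φ n).normed volume) (P.region K) (fun y => g y i) x -
      (q n).toFun x i| ≤ X := by
    intro n x hx i
    have := hX n x hx i
    rwa [← hXe, ← ofReal_norm, ENNReal.ofReal_le_ofReal_iff hX0, Real.norm_eq_abs] at this
  -- `1 + Λ √#I(K) ≤ Λ_m` turns the bounds for `K` into bounds with `Λ_m`.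
  have hΛ : 1 + P.lebesgueConst m K * ENNReal.ofReal (Real.sqrt (P.patch K).card) ≤
      P.lebesgueMax m := by
    refine le_trans (le_of_eq ?_) (le_iSup (fun K => 1 + P.lebesgueConst m K *
      ((P.patch K).card : ℝ≥0∞) ^ (1 / 2 : ℝ)) K)
    rw [Real.sqrt_eq_rpow, ← ENNReal.ofReal_rpow_of_nonneg (by positivity) (by norm_num),
      ENNReal.ofReal_natCast]
  have hY : P.lebesgueConst m K * ENNReal.ofReal (4 * Real.sqrt (P.patch K).card * X) =
      4 * (P.lebesgueConst m K * ENNReal.ofReal (Real.sqrt (P.patch K).card)) *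
        ENNReal.ofReal X := by
    rw [ENNReal.ofReal_mul (by positivity), ENNReal.ofReal_mul (by norm_num)]
    norm_num
    ring
  set Z := 4 * P.lebesgueMax m * ENNReal.ofReal X with hZ
  have hsup : ∀ x ∈ closure (P.region K), ‖g x - p.toFun x‖ₑ ≤ Z := by
    intro x hx
    refine (hp.enorm_sub_le huni hg hq hE hu hXr x hx).trans ?_
    rw [hY, ENNReal.ofReal_mul (by norm_num), ENNReal.ofReal_ofNat]
    calc 2 * ENNReal.ofReal X + 4 * (P.lebesgueConst m K *
          ENNReal.ofReal (Real.sqrt (P.patch K).card)) * ENNReal.ofReal X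
        ≤ 4 * ENNReal.ofReal X + 4 * (P.lebesgueConst m K *
          ENNReal.ofReal (Real.sqrt (P.patch K).card)) * ENNReal.ofReal X := by
          gcongr
          norm_num
      _ = 4 * (1 + P.lebesgueConst m K * ENNReal.ofReal (Real.sqrt (P.patch K).card)) *
          ENNReal.ofReal X := by ring
      _ ≤ Z := by rw [hZ]; gcongr
  have hgrad : ∀ i j, weakDerivNorm (M.elem K) (unitIndex j)
      (fun x => (g x - p.toFun x) i) ≤ (1 + e) * Z := by
    intro i j
    obtain ⟨w, hw, hwL⟩ := hsob.1 i (unitIndex j) (by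
      fin_cases j <;> simp [unitIndex])
    have hwI : IntegrableOn w (P.region K) := by
      have : IsFiniteMeasure (volume.restrict (P.region K)) :=
        ⟨by rw [Measure.restrict_apply_univ]; exact (P.isBounded_region K).measure_lt_top⟩
      exact hwL.integrable (by norm_num)
    have hb := hp.eLpNorm_sub_pderiv_le huni hq hE hEm hu hXr hC₂0 (i := i) (j := j)
      (fun f hf B hB hfB => hC₂ _ (𝒯 K) (h𝒯 K).1 (h𝒯 K).2 (h𝒯' K) f hf B hB hfB j)
      (fun n => (contDiff_convOn (φ n).contDiff_normed (φ n).hasCompactSupport_normed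
        hDo.measurableSet hwI).continuous)
      (ae_tendsto_convOn hDo.measurableSet hwI hφ hφ')
      (fun n => by rw [hXe]; exact hX' n i j w hw)
    refine (iInf₂_le _ (hw.sub_eval hKp.isOpen hKD (p i))).trans (hb.trans ?_)
    have heC : ENNReal.ofReal C₂ = (e : ℝ≥0∞) := rfl
    rw [hY, heC]
    have h1 : ENNReal.ofReal X ≤ Z := by
      have : (1 : ℝ≥0∞) ≤ 4 * P.lebesgueMax m := by
        calc (1 : ℝ≥0∞) = 1 * 1 := (one_mul 1).symm
          _ ≤ 4 * P.lebesgueMax m := by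
            gcongr
            · norm_num
            · exact le_self_add.trans hΛ
      calc ENNReal.ofReal X = 1 * ENNReal.ofReal X := (one_mul _).symm
        _ ≤ Z := by rw [hZ]; gcongr
    have h2 : 4 * (P.lebesgueConst m K * ENNReal.ofReal (Real.sqrt (P.patch K).card)) *
        ENNReal.ofReal X ≤ Z := by
      rw [hZ]
      gcongr
      exact le_add_self.trans hΛ
    rw [add_mul, one_mul]
    gcongr
  -- The three estimates have the bound `Z` times a power of `h` times one of the three constants.
  have hab : ∀ k : ℝ≥0, k ≤ a + 2 * (1 + e) + b → ∀ t : ℝ, 0 ≤ t →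
      Z * (ENNReal.ofReal t * k) ≤ ((4 * C₁ * (a + 2 * (1 + e) + b) : ℝ≥0) : ℝ≥0∞) *
        P.lebesgueMax m * ENNReal.ofReal (t * d ^ m) * S := by
    intro k hk t ht
    rw [hZ, hXe, ENNReal.ofReal_mul ht]
    calc _ = 4 * C₁ * (k : ℝ≥0∞) * P.lebesgueMax m *
          (ENNReal.ofReal t * ENNReal.ofReal (d ^ m)) * S := by ring
      _ ≤ _ := by
          rw [ENNReal.coe_mul, ENNReal.coe_mul]
          gcongr
          norm_num
  refine ⟨?_, ?_, ?_⟩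
  · have hvol : (volume.restrict (M.elem K)) Set.univ ≤ ENNReal.ofReal (h ^ 2 * discArea) := by
      rw [Measure.restrict_apply_univ]
      exact volume_le_diam_sq hKp.isBounded
    have hda := discArea_pos
    refine (eLpNorm_two_le_of_forall_enorm_le (S := Z) (by positivity) ?_ hvol).trans
      (le_trans (le_of_eq ?_) (hab a (by rw [add_assoc]; exact le_self_add) h hh0))
    · filter_upwards [ae_restrict_mem hKp.isOpen.measurableSet] with x hx
      exact hsup x (subset_closure (hKD hx))
    · rw [Real.sqrt_mul (by positivity), Real.sqrt_sq hh0, ENNReal.ofReal_mul hh0]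
      rfl
  · refine (sobolevSeminorm_one_le hgrad).trans ?_
    have := hab (2 * (1 + e)) (by rw [add_right_comm]; exact le_add_self) 1 zero_le_one
    rw [ENNReal.ofReal_one, one_mul, one_mul] at this
    calc 2 * ((1 + e) * Z) = Z * ((2 * (1 + e) : ℝ≥0) : ℝ≥0∞) := by push_cast; ring
      _ ≤ _ := this
      _ ≤ _ := by
          rw [mul_assoc (_ : ℝ≥0∞) (P.lebesgueMax m)]
          gcongr
          exact le_add_self
  -- The frontier has length at most `3 N h`, and the uniform bound holds up to the frontier.
  · have hfr : ((Measure.hausdorffMeasure 1 : Measure Plane).restrict (frontier (M.elem K)))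
        Set.univ ≤ ENNReal.ofReal (3 * N * h) := by
      rw [Measure.restrict_apply_univ]
      exact hausdorffMeasure_frontier_le hKp (h𝒯 K).1 (h𝒯 K).2 fun T hT => (h𝒯' K T hT).1
    refine (eLpNorm_two_le_of_forall_enorm_le (S := Z) (by positivity) ?_ hfr).trans
      (le_trans (le_of_eq ?_) (hab b le_add_self (Real.sqrt h) (Real.sqrt_nonneg h)))
    · filter_upwards [ae_restrict_mem isClosed_frontier.measurableSet] with x hx
      exact hsup x (closure_mono hKD (frontier_subset_closure hx))
    · rw [Real.sqrt_mul (by positivity), ENNReal.ofReal_mul (by positivity), mul_comm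
        (ENNReal.ofReal _) (ENNReal.ofReal (Real.sqrt h))]
      rfl
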